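/- Let $\mathcal A$ be a commutative ring, $k$ an algebraically closed field that is an $\mathcal A$-algebra, and let $\beta=(b_1,\dots,b_n)\in\mathbb Q^n$ satisfy $0<b_i\le 1$ and $|\beta|=\sum b_i>r$. Let $U\subset\mathbb P^{n-1}\times\mathrm{Gr}(r,n)$ be the universal family of linear subspaces $\mathbb PV\subset\mathbb P^{n-1}$ ($V\subset\mathbb A^n$ of dimension $r$), with coordinates $z_i$ on $\mathbb P^{n-1}$ and Plücker coordinates $p_I$ on $\mathrm{Gr}(r,n)$. The torus $T=\mathbb G_m^n/\mathrm{diag}(\mathbb G_m)$ acts on $U$; $z_i$ has character $e_i$ and $p_I$ has character $e_I:=\sum_{i\in I}e_i$ in $\mathbb Z^n$. Polarize $U$ by the $\mathbb Q$-line bundle $p_1^*\mathcal O(|\beta|-r)\otimes p_2^*\mathcal O(1)$ with the $T$-linearization given by $\beta$: the invariant sections of its $N$-th power, for $N\ge1$ with $N\beta$ integral, are the classes of the polynomials over $\mathcal A$ in the $z_i,p_I$ of bidegree $(N(|\beta|-r),N)$ and character $N\beta$. A point $p\in U(k)$ is $\beta$-semistable if some such section, for some $N\ge 1$, does not vanish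 at $p$; it is $\beta$-stable if in addition its $T$-orbit is closed in the semistable locus of $U_k$ and its stabilizer in $T$ is finite. For $V\in\mathrm{Gr}(r,n)(k)$ let $P_V\subset\mathbb R^n$ be the matroid polytope, the convex hull of the $e_I$ with $p_I(V)\ne0$, let $\Delta_\beta=\{x\in\mathbb R^n : 0\le x_i\le b_i,\ \sum x_i=r\}$, let $\mathrm{Int}\,\Delta_\beta$ be its relative interior, and let $B_i=\{z_i=0\}\cap\mathbb PV$. The pair $(\mathbb PV,\sum b_iB_i)$ is lc (respectively klt) at $p\in\mathbb PV$ if no $B_i$ is all of $\mathbb PV$ and, for every nonempty $I\subset\{1,\dots,n\}$ with $p\in\bigcap_{i\in I}B_i$, one has $\sum_{i\in I}b_i\le\mathrm{codim}\bigcap_{i\in I}B_i$ (respectively $<$). Then, for every $V\in\mathrm{Gr}(r,n)(k)$: 1. If $P_V\cap\Delta_\beta=\emptyset$, or $V\subset\{z_i=0\}$ for some $i$, then no $p\in\mathbb PV$ is $\beta$-semistable. 2. If $P_V\cap\Delta_\beta\ne\emptyset$, then for every $p\in\mathbb PV$: $p$ is $\beta$-semistable if and only if $(\mathbb PV,\sum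 b_iB_i)$ is lc at $p$. 3. If $P_V\cap\mathrm{Int}\,\Delta_\beta\ne\emptyset$, then for every $p\in\mathbb PV$: $p$ is $\beta$-stable if and only if $(\mathbb PV,\sum b_iB_i)$ is klt at $p$. -/

import Mathlib

open scoped LinearAlgebra.Projectivization Pointwise

namespace HyperplaneGIT

noncomputable section

/-! ### Weights and polytopes -/

/-- The weight domain: rational weights `b` with `0 < b i ≤ 1` and `∑ b i > r`. -/
def weightDomain (r n : ℕ) : Set (Fin n → ℚ) :=
  {b | (∀ i, 0 < b i ∧ b i ≤ 1) ∧ (r : ℚ) < ∑ i, b i}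

/-- The weighted hypersimplex `Δ_β(r,n) = {0 ≤ x i ≤ b i, ∑ x i = r}` in `ℝⁿ`. -/
def weightedHypersimplex (r : ℕ) {n : ℕ} (b : Fin n → ℚ) : Set (Fin n → ℝ) :=
  {x | (∀ i, 0 ≤ x i ∧ x i ≤ (b i : ℝ)) ∧ ∑ i, x i = (r : ℝ)}

/-- The `r`-element subsets of `{0, …, n-1}`, which index the Plücker coordinates. -/
abbrev PluckerIndex (r n : ℕ) : Type := {I : Finset (Fin n) // I.card = r}

/-! ### The grassmannian and its universal family (points over a field `k`) -/

/-- The `k`-points of the grassmannian of `r`-dimensional subspaces of `kⁿ`. -/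
abbrev Gr (k : Type*) [Field k] (r n : ℕ) : Type _ :=
  {V : Submodule k (Fin n → k) // Module.finrank k V = r}

/-- The coordinate hyperplane `H i = {z i = 0}`, as a linear subspace of `kⁿ`. -/
def coordHyperplane (k : Type*) [Field k] {n : ℕ} (i : Fin n) : Submodule k (Fin n → k) :=
  LinearMap.ker (LinearMap.proj i : (Fin n → k) →ₗ[k] k)

/-- The `k`-points `(p, V)`, `p ∈ ℙV`, of the universal family `U ⊆ ℙⁿ⁻¹ × Gr(r,n)`. -/
@[ext]
structure UniversalFamily (k : Type*) [Field k] (r n : ℕ) where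
  /-- the point `p` of `ℙⁿ⁻¹` -/
  point : ℙ k (Fin n → k)
  /-- the linear space `V` -/
  space : Gr k r n
  point_mem : point.submodule ≤ space.1

variable {k : Type*} [Field k] {r n : ℕ}

/-- The Plücker coordinates of the subspace spanned by the rows `w`: the `I`-th one is the
maximal minor on the columns in `I`. -/
def minors (w : Fin r → Fin n → k) (I : PluckerIndex r n) : k :=
  Matrix.det (Matrix.of fun a c : Fin r => w a (I.1.orderEmbOfFin I.2 c))

/-- Plücker coordinates of `V`, with respect to some basis of `V`
(another basis multiplies all of them by one common nonzero scalar). -/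
def plucker (V : Gr k r n) : PluckerIndex r n → k :=
  minors fun a => ((Module.finBasisOfFinrankEq k V.1 V.2 a : V.1) : Fin n → k)

/-- The weight `∑_{i ∈ I} e i` of the Plücker coordinate `p_I`, as a point of `ℝⁿ`. -/
def indicatorPoint (I : PluckerIndex r n) : Fin n → ℝ := fun i => if i ∈ I.1 then 1 else 0

/-- The matroid polytope `P_V`: the moment polytope of `V`, that is, the convex hull of the
weights of the Plücker coordinates that do not vanish at `V`. -/
def matroidPolytope (V : Gr k r n) : Set (Fin n → ℝ) :=
  convexHull ℝ {x | ∃ I : PluckerIndex r n, plucker V I ≠ 0 ∧ x = indicatorPoint I}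

/-! ### Sections and the Zariski topology on the universal family -/

/-- The index set of the coordinates `z i` and `p_I` on `ℙⁿ⁻¹ × ℙ(⋀ʳ kⁿ)`. -/
abbrev Coord (r n : ℕ) : Type := Fin n ⊕ PluckerIndex r n

/-- The values of the coordinates `z i`, `p_I` at a point of `U`, for some choice of homogeneous
coordinates. Whether a bihomogeneous polynomial vanishes does not depend on the choice. -/
def UniversalFamily.coord (x : UniversalFamily k r n) : Coord r n → k :=
  Sum.elim x.point.rep (plucker x.space)

/-- The bidegree: `z i` has bidegree `(1,0)` and `p_I` has bidegree `(0,1)`. -/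
def bidegree (r n : ℕ) : Coord r n → ℕ × ℕ :=
  Sum.elim (fun _ => (1, 0)) (fun _ => (0, 1))

/-- The `ℤⁿ`-character: `z i` has character `e i` and `p_I` has character `∑_{i ∈ I} e i`. -/
def character (r n : ℕ) : Coord r n → Fin n → ℕ :=
  Sum.elim (fun i j => if j = i then 1 else 0) (fun I j => if j ∈ I.1 then 1 else 0)

/-- The Zariski topology on the `k`-points of `U ⊆ ℙⁿ⁻¹ × ℙ(⋀ʳ kⁿ)`: a basis of open sets is
given by the nonvanishing loci of bihomogeneous polynomials in the `z i` and `p_I`. -/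
instance : TopologicalSpace (UniversalFamily k r n) :=
  TopologicalSpace.generateFrom
    {W | ∃ (d : ℕ × ℕ) (F : MvPolynomial (Coord r n) k),
      MvPolynomial.IsWeightedHomogeneous (bidegree r n) F d ∧
      W = {x | MvPolynomial.aeval x.coord F ≠ 0}}

/-- `s ∈ A[z i, p_I]` represents a `T`-invariant section of the `N`-th power of the `ℚ`-line bundle
`L_{|β|-r, 1}` on `U` over `A`, for the linearization given by `β`: it has bidegree
`N • (|β| - r, 1)` and its `ℤⁿ`-character is `N • β`. -/
def IsInvariantSection {A : Type*} [CommRing A] (b : Fin n → ℚ) (N : ℕ)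
    (s : MvPolynomial (Coord r n) A) : Prop :=
  ∃ (a : ℕ) (c : Fin n → ℕ), (a : ℚ) = N * (∑ i, b i - r) ∧ (∀ i, (c i : ℚ) = N * b i) ∧
    MvPolynomial.IsWeightedHomogeneous (bidegree r n) s (a, N) ∧
    MvPolynomial.IsWeightedHomogeneous (character r n) s c

/-- A geometric point of `U` is `β`-semistable if some invariant section (defined over the base
ring `A`) of a positive power of the polarization does not vanish at it. -/
def IsSemistable (A : Type*) [CommRing A] [Algebra A k] (b : Fin n → ℚ)
    (x : UniversalFamily k r n) : Prop :=
  ∃ (N : ℕ) (s : MvPolynomial (Coord r n) A), 0 < N ∧ IsInvariantSection b N s ∧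
    MvPolynomial.aeval x.coord s ≠ 0

/-! ### The torus action -/

/-- The coordinatewise action of `𝔾_mⁿ` on `kⁿ` is linear. -/
instance : SMulCommClass (Fin n → kˣ) k (Fin n → k) :=
  ⟨fun t c v => funext fun i => smul_comm (t i) c (v i)⟩

/-- The big torus `𝔾_mⁿ` acts on `U`, through its coordinatewise action on `kⁿ`. -/
instance : MulAction (Fin n → kˣ) (UniversalFamily k r n) where
  smul t x :=
    { point := t • x.point
      space := ⟨t • x.space.1, by
        have h := LinearEquiv.finrank_map_eq
          (DistribMulAction.toLinearEquiv k (Fin n → k) t) x.space.1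
        exact h.trans x.space.2⟩
      point_mem := by
        obtain ⟨p, V, h⟩ := x
        induction p using Projectivization.ind with
        | h v hv =>
          rw [Projectivization.smul_mk]
          rw [Projectivization.submodule_mk, Submodule.span_singleton_le_iff_mem] at h ⊢
          exact Submodule.smul_mem_pointwise_smul v t V.1 h }
  one_smul x := UniversalFamily.ext (one_smul _ x.point) (Subtype.ext (one_smul _ x.space.1))
  mul_smul s t x :=
    UniversalFamily.ext (mul_smul s t x.point) (Subtype.ext (mul_smul s t x.space.1))

/-- The diagonal `𝔾_m` in `𝔾_mⁿ`. -/
def diagonal (k : Type*) [Field k] (n : ℕ) : Subgroup (Fin n → kˣ) :=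
  (MonoidHom.pi fun _ : Fin n => MonoidHom.id kˣ).range

/-- The torus `T = 𝔾_mⁿ / diag 𝔾_m`. -/
abbrev Torus (k : Type*) [Field k] (n : ℕ) : Type _ := (Fin n → kˣ) ⧸ diagonal k n

theorem diagonal_smul (t : Fin n → kˣ) (ht : t ∈ diagonal k n) (x : UniversalFamily k r n) :
    t • x = x := by
  obtain ⟨c, rfl⟩ := ht
  have hc : ∀ v : Fin n → k,
      ((MonoidHom.pi fun _ : Fin n => MonoidHom.id kˣ) c) • v = (c : k) • v := fun v => rfl
  refine UniversalFamily.ext ?_ (Subtype.ext ?_)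
  · change _ • x.point = x.point
    induction x.point using Projectivization.ind with
    | h v hv =>
      rw [Projectivization.smul_mk, Projectivization.mk_eq_mk_iff']
      exact ⟨c, (hc v).symm⟩
  · change _ • x.space.1 = x.space.1
    ext v
    rw [Submodule.mem_smul_pointwise_iff_exists]
    constructor
    · rintro ⟨w, hw, rfl⟩
      rw [hc]
      exact x.space.1.smul_mem _ hw
    · intro hv
      refine ⟨((c⁻¹ : kˣ) : k) • v, x.space.1.smul_mem _ hv, ?_⟩
      rw [hc, smul_smul, Units.mul_inv, one_smul]

/-- The induced action of the torus `T` on `U`. -/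
instance : MulAction (Torus k n) (UniversalFamily k r n) :=
  MulAction.compHom (UniversalFamily k r n)
    (QuotientGroup.lift (diagonal k n) (MulAction.toPermHom (Fin n → kˣ) (UniversalFamily k r n))
      (fun t ht => Equiv.ext fun x => diagonal_smul t ht x))

/-- A geometric point of `U` is (properly) `β`-stable if it is `β`-semistable, its `T`-orbit is
closed in the semistable locus, and its stabilizer in `T` is finite. -/
def IsStable (A : Type*) [CommRing A] [Algebra A k] (b : Fin n → ℚ)
    (x : UniversalFamily k r n) : Prop :=
  IsSemistable A b x ∧
  IsClosed ((Subtype.val : {y : UniversalFamily k r n // IsSemistable A b y} → _) ⁻¹'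
    MulAction.orbit (Torus k n) x) ∧
  Finite (MulAction.stabilizer (Torus k n) x)

/-! ### Singularities of the pair `(ℙV, ∑ b i B i)`, where `B i = H i ∩ ℙV` -/

/-- The linear subspace of `V` whose projectivization is the intersection `⋂_{i ∈ I} B i`. -/
def intersection (V : Gr k r n) (I : Finset (Fin n)) : Submodule k (Fin n → k) :=
  V.1 ⊓ ⨅ i ∈ I, coordHyperplane k i

/-- The codimension of `⋂_{i ∈ I} B i` in `ℙV`, as a rational number. -/
def codim (V : Gr k r n) (I : Finset (Fin n)) : ℚ :=
  (Module.finrank k V.1 : ℚ) - Module.finrank k (intersection V I)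

/-- `∑ b i B i` is a divisor on `ℙV`: every `B i` that occurs in it is a hyperplane of `ℙV`, that
is, `ℙV` is not contained in `H i`. -/
def IsDivisor (b : Fin n → ℚ) (V : Gr k r n) : Prop :=
  ∀ i, b i ≠ 0 → ¬ V.1 ≤ coordHyperplane k i

/-- The hyperplane arrangement `(ℙV, ∑ b i B i)` is log canonical at `p`: it is a pair, and for each
intersection `⋂_{i ∈ I} B i` through `p`, of codimension `c`, one has `∑_{i ∈ I} b i ≤ c`. -/
def IsLCAt (b : Fin n → ℚ) (x : UniversalFamily k r n) : Prop :=
  IsDivisor b x.space ∧ ∀ I : Finset (Fin n), I.Nonempty →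
    x.point.submodule ≤ intersection x.space I → ∑ i ∈ I, b i ≤ codim x.space I

/-- The hyperplane arrangement `(ℙV, ∑ b i B i)` is Kawamata log terminal at `p`: the inequalities
that define log canonical are strict. -/
def IsKLTAt (b : Fin n → ℚ) (x : UniversalFamily k r n) : Prop :=
  IsDivisor b x.space ∧ ∀ I : Finset (Fin n), I.Nonempty →
    x.point.submodule ≤ intersection x.space I → ∑ i ∈ I, b i < codim x.space I

end

end HyperplaneGIT

open HyperplaneGIT

open scoped LinearAlgebra.Projectivization Pointwise

namespace HyperplaneGIT

noncomputable section

/-! ### Bases and rank of the matroid of `V` -/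

section LinearAlgebra

variable {k : Type*} [Field k] {r n : ℕ}

/-! The torus acts diagonally on the coordinates, so everything reduces to monomials and convex
geometry. If an invariant section does not vanish at `(p, V)`, one of its monomials does not, so
semistability asks for an invariant monomial in coordinates that are nonzero at `(p, V)`. Divide its
exponents by `N`: the Plücker part becomes a point `y` of `P_V`, and the exponent of `z i` becomes
the slack `b i - y i`. Hence semistability means that `P_V` contains some `y ≤ b` with `y i = b i`
wherever `z i` vanishes at `p` (`isSemistable_iff`).

The codimension of `⋂_{i ∈ C} B i` is the rank of `C` in the matroid of `V`, and it bounds `∑_{i ∈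
C} y i` on `P_V`. So semistable points are lc. The converse is a matroid exchange argument
(`exists_le_and_eqOn`): if a maximal `y ≤ b` falls short of `b` at a vanishing coordinate, then the
coordinates from which mass could be moved there form a tight set, on which the lc inequality fails.

If the klt inequality is not strict on `C`, the one-parameter subgroup with weight 0 on `C` and 1
elsewhere moves `x` to a semistable limit that it fixes. For stable `x` the limit lies in the orbit,
so the stabilizer of `x` is infinite, a contradiction (`isKLTAt_of_isStable`).

Conversely, at a klt point with some `y < b` in `P_V`, there is room to make every nonvanishing
coordinate occur in one invariant monomial (`exists_full_exponent`). A semistable point of the orbit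
closure then has the same vanishing coordinates as `x` and satisfies the same binomial equations.
Since `kˣ` is divisible, the ratios of coordinates come from a torus element
(`mem_orbit_of_mem_closure`). The stabilizer is trivial by another exchange argument
(`mem_diagonal_of_smul_eq`). -/

theorem mem_intersection {V : Gr k r n} {C : Finset (Fin n)} {v : Fin n → k} :
    v ∈ intersection V C ↔ v ∈ V.1 ∧ ∀ i ∈ C, v i = 0 := by
  simp [intersection, coordHyperplane]

/-- `I` is a basis of the matroid of `V`: it has `r` elements, and a vector of `V` is determined by
its coordinates in `I`. -/
def IsBase (V : Gr k r n) (I : Finset (Fin n)) : Prop :=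
  I.card = r ∧ ∀ v ∈ V.1, (∀ i ∈ I, v i = 0) → v = 0

/-- The coordinates in `C` of the vectors of `V`. -/
def restrict (V : Gr k r n) (C : Finset (Fin n)) : V.1 →ₗ[k] (C → k) :=
  LinearMap.pi fun i => LinearMap.proj i.1 ∘ₗ V.1.subtype

/-- Rank-nullity for the restriction to `C`, whose kernel is `intersection V C`. This identifies
`codim` with the rank function of the matroid. -/
theorem codim_eq_finrank_range (V : Gr k r n) (C : Finset (Fin n)) :
    codim V C = Module.finrank k (LinearMap.range (restrict V C)) := by
  have h1 := LinearMap.finrank_range_add_finrank_ker (restrict V C)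
  have h2 : (LinearMap.ker (restrict V C)).map V.1.subtype = intersection V C := by
    ext v
    rw [mem_intersection, Submodule.mem_map]
    constructor
    · rintro ⟨w, hw, rfl⟩
      exact ⟨w.2, fun i hi => congrFun (LinearMap.mem_ker.1 hw) ⟨i, hi⟩⟩
    · rintro ⟨hv, h⟩
      exact ⟨⟨v, hv⟩, LinearMap.mem_ker.2 (funext fun i => h i.1 i.2), rfl⟩
  have h3 : Module.finrank k (intersection V C) =
      Module.finrank k (LinearMap.ker (restrict V C)) := by
    rw [← h2]
    exact (Submodule.equivMapOfInjective _ V.1.injective_subtype _).finrank_eq.symm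
  rw [codim, h3, ← h1]
  push_cast
  ring

theorem codim_mono (V : Gr k r n) {C D : Finset (Fin n)} (h : C ⊆ D) : codim V C ≤ codim V D := by
  have : intersection V D ≤ intersection V C := fun v hv =>
    mem_intersection.2 ⟨(mem_intersection.1 hv).1, fun i hi => (mem_intersection.1 hv).2 i (h hi)⟩
  have h2 : (Module.finrank k (intersection V D) : ℚ) ≤ Module.finrank k (intersection V C) := by
    exact_mod_cast Submodule.finrank_mono this
  rw [codim, codim]
  linarith

theorem restrict_surjective {V : Gr k r n} {I : Finset (Fin n)} (hI : IsBase V I) :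
    Function.Surjective (restrict V I) := by
  rw [← LinearMap.injective_iff_surjective_of_finrank_eq_finrank]
  · rw [← LinearMap.ker_eq_bot, LinearMap.ker_eq_bot']
    intro v hv
    exact Subtype.ext (hI.2 v.1 v.2 fun i hi => congrFun hv ⟨i, hi⟩)
  · rw [V.2, Module.finrank_fintype_fun_eq_card, Fintype.card_coe, hI.1]

theorem IsBase.exists_eq {V : Gr k r n} {I : Finset (Fin n)} (hI : IsBase V I) (f : Fin n → k) :
    ∃ v ∈ V.1, ∀ i ∈ I, v i = f i := by
  obtain ⟨v, hv⟩ := restrict_surjective hI fun i => f i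
  exact ⟨v.1, v.2, fun i hi => congrFun hv ⟨i, hi⟩⟩

theorem IsBase.codim_subset {V : Gr k r n} {I J : Finset (Fin n)} (hI : IsBase V I) (hJ : J ⊆ I) :
    codim V J = J.card := by
  have : LinearMap.range (restrict V J) = ⊤ := by
    rw [LinearMap.range_eq_top]
    intro f
    obtain ⟨v, hv, h⟩ := hI.exists_eq fun i => if hi : i ∈ J then f ⟨i, hi⟩ else 0
    refine ⟨⟨v, hv⟩, funext fun i => ?_⟩
    have := h i.1 (hJ i.2)
    simpa [restrict] using this
  rw [codim_eq_finrank_range, this, finrank_top, Module.finrank_fintype_fun_eq_card,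
    Fintype.card_coe]

theorem IsBase.card_inter_le {V : Gr k r n} {I : Finset (Fin n)} (hI : IsBase V I)
    (C : Finset (Fin n)) : ((I ∩ C).card : ℚ) ≤ codim V C := by
  rw [← hI.codim_subset Finset.inter_subset_left]
  exact codim_mono V Finset.inter_subset_right

/-- A set into which no basis exchange from `I` leads has as many elements in `I` as possible. -/
theorem IsBase.card_inter_eq {V : Gr k r n} {I : Finset (Fin n)} (hI : IsBase V I)
    {D : Finset (Fin n)}
    (hD : ∀ l ∈ D, l ∉ I → ∀ j ∈ I, IsBase V (insert l (I.erase j)) → j ∈ D) :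
    ((I ∩ D).card : ℚ) = codim V D := by
  refine le_antisymm (hI.card_inter_le D) ?_
  rw [← hI.codim_subset Finset.inter_subset_left]
  have key : intersection V (I ∩ D) ≤ intersection V D := by
    intro v hv
    rw [mem_intersection] at hv ⊢
    refine ⟨hv.1, fun l hl => ?_⟩
    by_cases hlI : l ∈ I
    · exact hv.2 l (Finset.mem_inter.2 ⟨hlI, hl⟩)
    -- For `j ∈ I` these vectors are the basis of `V` dual to the coordinates in `I`. If `w j l ≠
    -- 0`, replacing `j` by `l` gives another basis, so `j ∈ D` and `v j = 0`. Every term of the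
    -- expansion of `v l` therefore vanishes.
    have hdual : ∀ j : Fin n, ∃ w ∈ V.1, ∀ i ∈ I, w i = (Pi.single j 1 : Fin n → k) i :=
      fun j => hI.exists_eq _
    choose w hwV hw using hdual
    have hexp : ∀ u ∈ V.1, u = ∑ j ∈ I, u j • w j := by
      intro u hu
      refine sub_eq_zero.1 (hI.2 _ (V.1.sub_mem hu
        (V.1.sum_mem fun j _ => V.1.smul_mem _ (hwV j))) fun i hi => ?_)
      rw [Pi.sub_apply, Finset.sum_apply, sub_eq_zero]
      have : ∀ j ∈ I, (u j • w j) i = if i = j then u j else 0 := by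
        intro j _
        rw [Pi.smul_apply, hw j i hi, Pi.single_apply]
        split_ifs <;> simp
      rw [Finset.sum_congr rfl this, Finset.sum_ite_eq, if_pos hi]
    have hexp' : ∀ u ∈ V.1, u l = ∑ j ∈ I, u j * w j l := by
      intro u hu
      conv_lhs => rw [hexp u hu]
      simp
    rw [hexp' v hv.1]
    refine Finset.sum_eq_zero fun j hj => ?_
    by_contra hne
    have hvj : v j ≠ 0 := left_ne_zero_of_mul hne
    have hwj : w j l ≠ 0 := right_ne_zero_of_mul hne
    refine hvj (hv.2 j (Finset.mem_inter.2 ⟨hj, hD l hl hlI j hj ⟨?_, ?_⟩⟩))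
    · rw [Finset.card_insert_of_notMem (fun h => hlI (Finset.mem_of_mem_erase h)),
        Finset.card_erase_add_one hj, hI.1]
    · intro u hu hz
      have h1 : u j = 0 := by
        have h2 := hexp' u hu
        rw [hz l (Finset.mem_insert_self _ _), Finset.sum_eq_single_of_mem j hj] at h2
        · exact (mul_eq_zero.1 h2.symm).resolve_right hwj
        · intro i hi hij
          rw [hz i (Finset.mem_insert_of_mem (Finset.mem_erase.2 ⟨hij, hi⟩)), zero_mul]
      refine hI.2 u hu fun i hi => ?_
      by_cases hij : i = j
      · rw [hij, h1]
      · exact hz i (Finset.mem_insert_of_mem (Finset.mem_erase.2 ⟨hij, hi⟩))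
  have h2 : (Module.finrank k (intersection V (I ∩ D)) : ℚ) ≤ Module.finrank k (intersection V D) := by
    exact_mod_cast Submodule.finrank_mono key
  rw [codim, codim]
  linarith

/-! ### Plücker coordinates -/

/-- The determinant of the columns `f 0, …, f (r-1)` of the matrix with rows `w`. -/
def columnDet (w : Fin r → Fin n → k) (f : Fin r → Fin n) : k :=
  Matrix.det (Matrix.of fun a c : Fin r => w a (f c))

theorem minors_sum (B : Fin r → Fin n → k) (T : Matrix (Fin r) (Fin r) k) (I : PluckerIndex r n) :
    minors (fun a => ∑ d, T a d • B d) I = T.det * minors B I := by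
  rw [minors, minors, ← Matrix.det_mul]
  congr 1
  ext a c
  simp [Matrix.mul_apply]

/-- The factor is the determinant of the matrix expressing `w` in the chosen basis. This makes the
choice of basis in `plucker` harmless. -/
theorem exists_minors_eq (V : Gr k r n) {w : Fin r → Fin n → k} (hw : ∀ a, w a ∈ V.1)
    (hli : LinearIndependent k w) : ∃ c : k, c ≠ 0 ∧ ∀ I, minors w I = c * plucker V I := by
  let B := Module.finBasisOfFinrankEq k V.1 V.2
  let T : Matrix (Fin r) (Fin r) k := Matrix.of fun a d => B.repr ⟨w a, hw a⟩ d
  have hT : w = fun a => ∑ d, T a d • ((B d : V.1) : Fin n → k) := by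
    funext a
    have := congrArg Subtype.val (B.sum_repr ⟨w a, hw a⟩)
    rw [← Submodule.coe_subtype, map_sum] at this
    simpa [T] using this.symm
  refine ⟨T.det, fun h => ?_, fun I => ?_⟩
  · obtain ⟨c, hc, hc0⟩ := Matrix.exists_vecMul_eq_zero_iff.2 h
    refine hc (funext fun a => ?_)
    refine Fintype.linearIndependent_iff.1 hli c ?_ a
    rw [hT]
    simp only [Finset.smul_sum, smul_smul]
    rw [Finset.sum_comm]
    refine Finset.sum_eq_zero fun d _ => ?_
    rw [← Finset.sum_smul]
    have := congrFun hc0 d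
    rw [Matrix.vecMul, dotProduct] at this
    rw [this, Pi.zero_apply, zero_smul]
  · conv_lhs => rw [hT]
    exact minors_sum _ T I

theorem plucker_ne_zero_iff (V : Gr k r n) (I : PluckerIndex r n) :
    plucker V I ≠ 0 ↔ IsBase V I.1 := by
  let B := Module.finBasisOfFinrankEq k V.1 V.2
  have hcol : ∀ (c : Fin r → k) (j : Fin r),
      Matrix.vecMul c (Matrix.of fun a c : Fin r =>
        ((B a : V.1) : Fin n → k) (I.1.orderEmbOfFin I.2 c)) j =
      ((∑ a, c a • B a : V.1) : Fin n → k) (I.1.orderEmbOfFin I.2 j) := by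
    intro c j
    simp [Matrix.vecMul, dotProduct]
  constructor
  · intro h
    refine ⟨I.2, fun v hv h0 => ?_⟩
    by_contra hne
    refine h (Matrix.exists_vecMul_eq_zero_iff.1 ⟨fun a => B.repr ⟨v, hv⟩ a, fun hz => hne ?_, ?_⟩)
    · have h2 := B.sum_repr ⟨v, hv⟩
      rw [Finset.sum_eq_zero fun a _ => by rw [show B.repr ⟨v, hv⟩ a = 0 from congrFun hz a,
        zero_smul]] at h2
      exact (congrArg Subtype.val h2).symm
    · funext j
      refine (hcol _ j).trans ?_
      rw [B.sum_repr]
      exact h0 _ (Finset.orderEmbOfFin_mem _ _ _)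
  · intro hI h
    obtain ⟨c, hc, hc0⟩ := Matrix.exists_vecMul_eq_zero_iff.2 h
    have h1 : (∑ a, c a • B a : V.1) = 0 := by
      refine Subtype.ext (hI.2 _ (Subtype.prop _) fun i hi => ?_)
      obtain ⟨j, rfl⟩ : i ∈ Set.range (I.1.orderEmbOfFin I.2) := by
        rw [Finset.range_orderEmbOfFin]; exact hi
      rw [← hcol, show Matrix.vecMul c _ = 0 from hc0, Pi.zero_apply]
    exact hc (funext fun a => Fintype.linearIndependent_iff.1 B.linearIndependent c h1 a)

/-- Passes from increasing column sequences to arbitrary ones: an injective `f` is a permutation of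
an increasing sequence, and a repeated column gives determinant zero on both sides. -/
theorem columnDet_eq_of_minors_eq {w w' : Fin r → Fin n → k} {c : k}
    (h : ∀ I, minors w' I = c * minors w I) (f : Fin r → Fin n) :
    columnDet w' f = c * columnDet w f := by
  by_cases hf : Function.Injective f
  · let I : PluckerIndex r n := ⟨Finset.univ.image f, by
      rw [Finset.card_image_of_injective _ hf, Finset.card_fin]⟩
    have hmem : ∀ a, f a ∈ I.1 := fun a => Finset.mem_image_of_mem f (Finset.mem_univ a)
    let s : Fin r → Fin r := fun a => (I.1.orderIsoOfFin I.2).symm ⟨f a, hmem a⟩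
    have hs : ∀ a, I.1.orderEmbOfFin I.2 (s a) = f a := by
      intro a
      rw [← Finset.coe_orderIsoOfFin_apply]
      simp [s]
    have hsi : Function.Injective s := by
      intro a a' haa
      apply hf
      rw [← hs a, ← hs a', haa]
    let σ : Equiv.Perm (Fin r) := Equiv.ofBijective s (Finite.injective_iff_bijective.1 hsi)
    have key : ∀ u : Fin r → Fin n → k,
        columnDet u f = ((Equiv.Perm.sign σ : ℤ) : k) * minors u I := by
      intro u
      rw [minors, ← Matrix.det_permute']
      unfold columnDet
      congr 1
      ext a d
      simp only [Matrix.of_apply, Matrix.submatrix_apply, id]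
      rw [show σ d = s d from rfl, hs]
    rw [key, key, h]
    ring
  · obtain ⟨a, a', haa, hne⟩ : ∃ a a', f a = f a' ∧ a ≠ a' := by
      simpa [Function.Injective] using hf
    have key : ∀ u : Fin r → Fin n → k, columnDet u f = 0 := fun u =>
      Matrix.det_zero_of_column_eq hne fun d => by simp [haa]
    rw [key, key, mul_zero]

/-- Cramer's rule for the `j`-th column in terms of the columns `f`, read off in row `d`. -/
theorem mul_columnDet (w : Fin r → Fin n → k) (f : Fin r → Fin n) (d : Fin r) (j : Fin n) :
    columnDet w f * w d j = ∑ a, w d (f a) * columnDet w (Function.update f a j) := by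
  have h := congrFun (Matrix.mulVec_cramer (Matrix.of fun a c : Fin r => w a (f c))
    (fun a => w a j)) d
  rw [Matrix.mulVec, dotProduct, Pi.smul_apply, smul_eq_mul] at h
  rw [columnDet, ← h]
  refine Finset.sum_congr rfl fun a _ => ?_
  rw [Matrix.cramer_apply, Matrix.of_apply, columnDet]
  congr 2
  ext x y
  by_cases hy : y = a
  · subst hy; simp
  · simp [hy]

/-- A linear subspace is determined by its Plücker coordinates. -/
theorem eq_of_plucker_eq {V V' : Gr k r n} {c : k} (h : ∀ I, plucker V' I = c * plucker V I)
    (I : PluckerIndex r n) (hI : plucker V' I ≠ 0) : V = V' := by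
  have hc : c ≠ 0 := by rintro rfl; exact hI (by rw [h, zero_mul])
  have hIV : plucker V I ≠ 0 := by intro h0; exact hI (by rw [h, h0, mul_zero])
  let w : Fin r → Fin n → k := fun a => ((Module.finBasisOfFinrankEq k V.1 V.2 a : V.1) : Fin n → k)
  let w' : Fin r → Fin n → k :=
    fun a => ((Module.finBasisOfFinrankEq k V'.1 V'.2 a : V'.1) : Fin n → k)
  have hD : ∀ f, columnDet w' f = c * columnDet w f := columnDet_eq_of_minors_eq h
  let f := I.1.orderEmbOfFin I.2
  -- Linear equations with Plücker coefficients. They hold on `V` by Cramer's rule, and on `V'`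
  -- because its coefficients differ only by the factor `c`. A solution vanishing on the columns `f`
  -- is zero, so each vector of `V'` equals the vector of `V` with the same coordinates in `I`.
  let G : Submodule k (Fin n → k) :=
    { carrier := {v | ∀ j, columnDet w f * v j = ∑ a, v (f a) * columnDet w (Function.update f a j)}
      add_mem' := by
        intro u v hu hv j
        simp only [Pi.add_apply, mul_add, add_mul, Finset.sum_add_distrib]
        rw [hu j, hv j]
      zero_mem' := by intro j; simp
      smul_mem' := by
        intro e v hv j
        simp only [Pi.smul_apply, smul_eq_mul]
        rw [mul_left_comm, hv j, Finset.mul_sum]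
        exact Finset.sum_congr rfl fun a _ => by ring }
  have hspan : ∀ (W : Gr k r n), (∀ a, ((Module.finBasisOfFinrankEq k W.1 W.2 a : W.1) : Fin n → k) ∈ G) →
      W.1 ≤ G := by
    intro W hW v hv
    have h2 := congrArg Subtype.val ((Module.finBasisOfFinrankEq k W.1 W.2).sum_repr ⟨v, hv⟩)
    rw [← Submodule.coe_subtype, map_sum] at h2
    rw [← show _ = v from h2]
    exact G.sum_mem fun a _ => G.smul_mem _ (hW a)
  have hVG : V.1 ≤ G := hspan V fun a j => mul_columnDet w f a j
  have hVG' : V'.1 ≤ G := by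
    refine hspan V' fun a j => ?_
    have := mul_columnDet w' f a j
    simp only [hD] at this
    apply mul_left_cancel₀ hc
    rw [Finset.mul_sum, ← mul_assoc]
    refine this.trans (Finset.sum_congr rfl fun d _ => by ring)
  have hle : V'.1 ≤ V.1 := by
    intro v hv
    obtain ⟨u, hu, huv⟩ := ((plucker_ne_zero_iff V I).1 hIV).exists_eq v
    have hG := G.sub_mem (hVG hu) (hVG' hv)
    have : u - v = 0 := by
      funext j
      have hj := hG j
      rw [Finset.sum_eq_zero, mul_eq_zero] at hj
      · exact hj.resolve_left hIV
      · intro a _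
        rw [Pi.sub_apply, huv _ (Finset.orderEmbOfFin_mem _ _ _), sub_self, zero_mul]
    rw [← sub_eq_zero.1 this]
    exact hu
  exact Subtype.ext (Submodule.eq_of_le_of_finrank_eq hle (V'.2.trans V.2.symm)).symm

end LinearAlgebra

/-! ### The matroid polytope -/

section Polytope

variable {k : Type*} [Field k] {r n : ℕ}

/-- Indexing the weights by all Plücker indices, with a support condition, lets them serve directly
as exponents of the `p_I`. -/
theorem mem_matroidPolytope {V : Gr k r n} {y : Fin n → ℝ} :
    y ∈ matroidPolytope V ↔ ∃ c : PluckerIndex r n → ℝ, (∀ I, 0 ≤ c I) ∧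
      (∀ I, c I ≠ 0 → plucker V I ≠ 0) ∧ ∑ I, c I = 1 ∧
      y = ∑ I, c I • indicatorPoint I := by
  constructor
  · intro hy
    let K : Set (Fin n → ℝ) := {y | ∃ c : PluckerIndex r n → ℝ, (∀ I, 0 ≤ c I) ∧
      (∀ I, c I ≠ 0 → plucker V I ≠ 0) ∧ ∑ I, c I = 1 ∧ y = ∑ I, c I • indicatorPoint I}
    have hK : Convex ℝ K := by
      rintro _ ⟨c, hc0, hcV, hc1, rfl⟩ _ ⟨d, hd0, hdV, hd1, rfl⟩ s t hs ht hst
      refine ⟨fun I => s * c I + t * d I, fun I => by have := hc0 I; have := hd0 I; positivity,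
        fun I h => ?_, ?_, ?_⟩
      · by_cases h1 : c I = 0
        · by_cases h2 : d I = 0
          · simp [h1, h2] at h
          · exact hdV I h2
        · exact hcV I h1
      · rw [Finset.sum_add_distrib, ← Finset.mul_sum, ← Finset.mul_sum, hc1, hd1, mul_one, mul_one,
          hst]
      · simp only [add_smul, Finset.sum_add_distrib, Finset.smul_sum, smul_smul]
    refine convexHull_min ?_ hK hy
    rintro _ ⟨I, hI, rfl⟩
    refine ⟨Pi.single I 1, fun J => ?_, fun J hJ => ?_, by simp, ?_⟩
    · by_cases h : J = I
      · subst h; simp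
      · simp [h]
    · by_cases h : J = I
      · subst h; exact hI
      · simp [h] at hJ
    · rw [Finset.sum_eq_single I]
      · simp
      · intro J _ hJ; simp [hJ]
      · simp
  · rintro ⟨c, hc0, hcV, hc1, rfl⟩
    classical
    rw [← Finset.sum_filter_of_ne (p := fun I => c I ≠ 0)
      (fun I _ h => by rintro h0; simp [h0] at h)]
    refine (convex_convexHull ℝ _).sum_mem (fun I _ => hc0 I) ?_ fun I hI =>
      subset_convexHull ℝ _ ⟨I, hcV I (Finset.mem_filter.1 hI).2, rfl⟩
    rw [Finset.sum_filter_ne_zero, hc1]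

theorem sum_indicatorPoint (I : PluckerIndex r n) (C : Finset (Fin n)) :
    ∑ i ∈ C, indicatorPoint I i = (I.1 ∩ C).card := by
  simp [indicatorPoint, Finset.sum_ite_mem, Finset.inter_comm]

theorem sum_combination (c : PluckerIndex r n → ℝ) (C : Finset (Fin n)) :
    ∑ i ∈ C, (∑ I, c I • indicatorPoint I) i = ∑ I, c I * (I.1 ∩ C).card := by
  simp only [Finset.sum_apply, Pi.smul_apply, smul_eq_mul]
  rw [Finset.sum_comm]
  exact Finset.sum_congr rfl fun I _ => by rw [← Finset.mul_sum, sum_indicatorPoint]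

theorem sum_le_codim {V : Gr k r n} {y : Fin n → ℝ} (hy : y ∈ matroidPolytope V)
    (C : Finset (Fin n)) : ∑ i ∈ C, y i ≤ (codim V C : ℝ) := by
  obtain ⟨c, hc0, hcV, hc1, rfl⟩ := mem_matroidPolytope.1 hy
  rw [sum_combination, ← one_mul ((codim V C : ℚ) : ℝ), ← hc1, Finset.sum_mul]
  refine Finset.sum_le_sum fun I _ => ?_
  by_cases h : c I = 0
  · simp [h]
  · refine mul_le_mul_of_nonneg_left ?_ (hc0 I)
    exact_mod_cast ((plucker_ne_zero_iff V I).1 (hcV I h)).card_inter_le C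

theorem nonneg_of_mem_matroidPolytope {V : Gr k r n} {y : Fin n → ℝ} (hy : y ∈ matroidPolytope V)
    (i : Fin n) : 0 ≤ y i := by
  obtain ⟨c, hc0, -, -, rfl⟩ := mem_matroidPolytope.1 hy
  rw [Finset.sum_apply]
  refine Finset.sum_nonneg fun I _ => mul_nonneg (hc0 I) ?_
  rw [indicatorPoint]
  split_ifs <;> norm_num

theorem sum_eq_of_mem_matroidPolytope {V : Gr k r n} {y : Fin n → ℝ}
    (hy : y ∈ matroidPolytope V) : ∑ i, y i = r := by
  obtain ⟨c, -, -, hc1, rfl⟩ := mem_matroidPolytope.1 hy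
  rw [sum_combination]
  simp only [Finset.inter_univ]
  rw [Finset.sum_congr rfl fun I _ => by rw [I.2], ← Finset.sum_mul, hc1, one_mul]

theorem isCompact_matroidPolytope (V : Gr k r n) : IsCompact (matroidPolytope V) := by
  refine Set.Finite.isCompact_convexHull ℝ ((Set.finite_range (indicatorPoint (r := r))).subset ?_)
  rintro _ ⟨I, -, rfl⟩
  exact ⟨I, rfl⟩

/-- If, in the polytope, one cannot leave `C` by increasing a coordinate in `C` at the cost of one
outside `C`, then a convex combination of bases is tight on `C`. -/
theorem sum_eq_codim_of_closed {V : Gr k r n} {c : PluckerIndex r n → ℝ} (hc1 : ∑ I, c I = 1)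
    (hcV : ∀ I, c I ≠ 0 → plucker V I ≠ 0) {C : Finset (Fin n)}
    (hC : ∀ I : PluckerIndex r n, c I ≠ 0 → ∀ l ∈ C, l ∉ I.1 → ∀ j ∈ I.1,
      IsBase V (insert l (I.1.erase j)) → j ∈ C) :
    ∑ i ∈ C, (∑ I, c I • indicatorPoint I) i = (codim V C : ℝ) := by
  rw [sum_combination, ← one_mul ((codim V C : ℚ) : ℝ), ← hc1, Finset.sum_mul]
  refine Finset.sum_congr rfl fun I _ => ?_
  by_cases h : c I = 0
  · simp [h]
  · congr 1
    exact_mod_cast ((plucker_ne_zero_iff V I).1 (hcV I h)).card_inter_eq (hC I h)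

/-- The whole weight of `I` is transferred to the exchanged basis. -/
theorem exchange_mem {V : Gr k r n} {c : PluckerIndex r n → ℝ} (hc0 : ∀ I, 0 ≤ c I)
    (hcV : ∀ I, c I ≠ 0 → plucker V I ≠ 0) (hc1 : ∑ I, c I = 1) (I : PluckerIndex r n)
    {l j : Fin n} (hl : l ∉ I.1) (hj : j ∈ I.1) (hb : IsBase V (insert l (I.1.erase j))) :
    (∑ I, c I • indicatorPoint I) + c I • (Pi.single l 1 - Pi.single j 1) ∈ matroidPolytope V := by
  classical
  let J : PluckerIndex r n := ⟨insert l (I.1.erase j), hb.1⟩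
  have hJI : J ≠ I := fun h => hl (by rw [← h]; exact Finset.mem_insert_self _ _)
  have hdiff : (Pi.single l 1 - Pi.single j 1 : Fin n → ℝ) = indicatorPoint J - indicatorPoint I := by
    have hlj : l ≠ j := by rintro rfl; exact hl hj
    funext i
    simp only [Pi.sub_apply, Pi.single_apply, indicatorPoint, J, Finset.mem_insert, Finset.mem_erase]
    by_cases h1 : i = l
    · subst h1; simp [hl, hlj]
    · by_cases h2 : i = j
      · subst h2; simp [h1, hj]
      · simp [h1, h2]
  refine mem_matroidPolytope.2
    ⟨c + c I • (Pi.single J 1 - Pi.single I 1), fun M => ?_, fun M hM => ?_, ?_, ?_⟩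
  · have := hc0 M
    have := hc0 I
    simp only [Pi.add_apply, Pi.smul_apply, Pi.sub_apply, Pi.single_apply, smul_eq_mul]
    split_ifs with h1 h2 h2
    · exact absurd (h1.symm.trans h2) hJI
    · linarith
    · subst h2; linarith
    · linarith
  · by_cases h1 : M = J
    · subst h1; exact (plucker_ne_zero_iff V _).2 hb
    · refine hcV M fun h => hM ?_
      by_cases h2 : M = I
      · subst h2; simp [h]
      · simp [h, h1, h2]
  · simp [Finset.sum_add_distrib, ← Finset.mul_sum, hc1]
  · have hs : ∀ M : PluckerIndex r n, ∑ K, (Pi.single M 1 : PluckerIndex r n → ℝ) K • indicatorPoint K =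
        indicatorPoint M := by
      intro M
      rw [Finset.sum_eq_single M]
      · simp
      · intro K _ hK; simp [hK]
      · simp
    simp only [Pi.add_apply, Pi.smul_apply, Pi.sub_apply, add_smul, Finset.sum_add_distrib, smul_assoc,
      sub_smul, ← Finset.smul_sum, Finset.sum_sub_distrib, hs, hdiff]

/-- A vector that is dominated on `Z` by the rank function, and that dominates some point of the
matroid polytope, dominates one with which it agrees on `Z`. -/
theorem exists_le_and_eqOn (V : Gr k r n) (b : Fin n → ℝ) (Z : Finset (Fin n))
    (hne : ∃ y ∈ matroidPolytope V, ∀ i, y i ≤ b i)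
    (hZ : ∀ C ⊆ Z, C.Nonempty → ∑ i ∈ C, b i ≤ (codim V C : ℝ)) :
    ∃ y ∈ matroidPolytope V, (∀ i, y i ≤ b i) ∧ ∀ i ∈ Z, y i = b i := by
  classical
  -- A maximizer of the total over `Z` exists by compactness. It must reach `b` everywhere on `Z`.
  obtain ⟨y, ⟨hyP, hyb⟩, hmax⟩ : ∃ y ∈ matroidPolytope V ∩ Set.Iic b,
      IsMaxOn (fun y => ∑ i ∈ Z, y i) (matroidPolytope V ∩ Set.Iic b) y := by
    exact ((isCompact_matroidPolytope V).inter_right isClosed_Iic).exists_isMaxOn hne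
      (Continuous.continuousOn (by fun_prop))
  refine ⟨y, hyP, hyb, fun i hi => ?_⟩
  by_contra hne'
  have hlt : y i < b i := lt_of_le_of_ne (hyb i) hne'
  -- `R i j` says that some mass can be moved from `j` to `i` without leaving the polytope.
  let R : Fin n → Fin n → Prop := fun i j => ∃ ε : ℝ, 0 < ε ∧
    y + ε • (Pi.single i 1 - Pi.single j 1) ∈ matroidPolytope V
  have htrans : ∀ {i j l}, R i j → R j l → R i l := by
    rintro i j l ⟨ε, hε, h1⟩ ⟨δ, hδ, h2⟩
    -- The weights `δ / (ε + δ)` and `ε / (ε + δ)` are chosen so that the contributions at `j`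
    -- cancel.
    refine ⟨ε * δ / (ε + δ), by positivity, ?_⟩
    have := convex_convexHull ℝ _ h1 h2 (a := δ / (ε + δ)) (b := ε / (ε + δ)) (by positivity)
      (by positivity) (by field_simp; ring)
    refine (congrArg (· ∈ matroidPolytope V) (funext fun m => ?_)).mpr this
    simp only [Pi.add_apply, Pi.smul_apply, Pi.sub_apply, smul_eq_mul]
    field_simp
    ring
  -- All places from which mass can reach `i`. Maximality forces `C ⊆ Z`, since mass from outside
  -- `Z` would increase the total. Transitivity makes `C` closed under exchange, hence tight, so
  -- that `codim V C = ∑ y < ∑ b` on `C`, against `hZ`.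
  let C : Finset (Fin n) := Finset.univ.filter (R i)
  have hiC : i ∈ C := Finset.mem_filter.2 ⟨Finset.mem_univ _, 1, one_pos, by simpa using hyP⟩
  have hCZ : C ⊆ Z := by
    intro j hj
    obtain ⟨ε, hε, hmem⟩ := (Finset.mem_filter.1 hj).2
    by_contra hjZ
    have hij : i ≠ j := by rintro rfl; exact hjZ hi
    let δ := min ε (b i - y i)
    have hδ : 0 < δ := lt_min hε (sub_pos.2 hlt)
    have hmem' : y + δ • (Pi.single i 1 - Pi.single j 1) ∈ matroidPolytope V := by
      have := (convex_convexHull ℝ _).add_smul_mem hyP hmem (t := δ / ε)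
        ⟨by positivity, (div_le_one hε).2 (min_le_left _ _)⟩
      rwa [smul_smul, div_mul_cancel₀ _ hε.ne'] at this
    have hle : ∀ m, (y + δ • (Pi.single i 1 - Pi.single j 1) : Fin n → ℝ) m ≤ b m := by
      intro m
      have h5 : δ ≤ b i - y i := min_le_right _ _
      have := hyb m
      simp only [Pi.add_apply, Pi.smul_apply, Pi.sub_apply, smul_eq_mul, Pi.single_apply]
      split_ifs with h1 h2 h2
      · exact absurd (h1.symm.trans h2) hij
      · subst h1; linarith
      · linarith
      · linarith
    have h3 : ∑ m ∈ Z, (y + δ • (Pi.single i 1 - Pi.single j 1) : Fin n → ℝ) m ≤ ∑ m ∈ Z, y m :=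
      hmax ⟨hmem', hle⟩
    have h4 : ∑ m ∈ Z, (y + δ • (Pi.single i 1 - Pi.single j 1) : Fin n → ℝ) m =
        ∑ m ∈ Z, y m + δ := by
      simp [Finset.sum_add_distrib, ← Finset.mul_sum, hi, hjZ]
    linarith
  obtain ⟨c, hc0, hcV, hc1, hyc⟩ := mem_matroidPolytope.1 hyP
  have htight : ∑ m ∈ C, y m = (codim V C : ℝ) := by
    rw [hyc]
    refine sum_eq_codim_of_closed hc1 hcV fun I hI l hl hlI j hj hbase => ?_
    refine Finset.mem_filter.2 ⟨Finset.mem_univ _, htrans (Finset.mem_filter.1 hl).2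
      ⟨c I, lt_of_le_of_ne (hc0 I) (Ne.symm hI), ?_⟩⟩
    rw [hyc]
    exact exchange_mem hc0 hcV hc1 I hlI hj hbase
  have h6 : ∑ m ∈ C, y m < ∑ m ∈ C, b m :=
    Finset.sum_lt_sum (fun m _ => hyb m) ⟨i, hiC, hlt⟩
  linarith [hZ C hCZ ⟨i, hiC⟩]

/-- Points of the relative interior of the weighted hypersimplex satisfy its inequalities strictly. -/
theorem lt_of_mem_intrinsicInterior {b : Fin n → ℚ} (hb : b ∈ weightDomain r n) {y : Fin n → ℝ}
    (hr : 0 < r) (hy : y ∈ intrinsicInterior ℝ (weightedHypersimplex r b)) (i : Fin n) :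
    0 < y i ∧ y i < b i := by
  let B : ℝ := ∑ i, (b i : ℝ)
  have hB : (r : ℝ) < B := by
    have := hb.2
    have : ((r : ℚ) : ℝ) < ((∑ i, b i : ℚ) : ℝ) := by exact_mod_cast this
    simpa [B] using this
  have hr' : (0 : ℝ) < r := by exact_mod_cast hr
  have hB0 : 0 < B := hr'.trans hB
  have hbpos : ∀ i, (0 : ℝ) < b i := fun i => by exact_mod_cast (hb.1 i).1
  -- A point satisfying all the inequalities strictly. The segment from `s` to `x` extends a little
  -- beyond `x` inside the hypersimplex, so no inequality can be an equality at `x`. Positivity of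
  -- `s` needs `r > 0`.
  let s : Fin n → ℝ := fun i => r / B * b i
  have hs0 : ∀ i, 0 < s i := fun i => mul_pos (by positivity) (hbpos i)
  have hsb : ∀ i, s i < b i := fun i =>
    mul_lt_of_lt_one_left (hbpos i) ((div_lt_one hB0).2 hB)
  have hsmem : s ∈ weightedHypersimplex r b := by
    refine ⟨fun i => ⟨(hs0 i).le, (hsb i).le⟩, ?_⟩
    rw [← Finset.mul_sum]
    exact div_mul_cancel₀ _ hB0.ne'
  obtain ⟨y', hy', rfl⟩ := mem_intrinsicInterior.1 hy
  let x : Fin n → ℝ := y'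
  let γ : ℝ → affineSpan ℝ (weightedHypersimplex r b) := fun t => ⟨s + t • (x - s), by
    have := AffineMap.lineMap_mem t (subset_affineSpan ℝ _ hsmem) y'.2
    rwa [AffineMap.lineMap_apply_module', add_comm] at this⟩
  have hcont : Continuous γ := by
    rw [continuous_induced_rng]
    change Continuous fun t : ℝ => s + t • (x - s)
    fun_prop
  have hopen := (isOpen_interior (s := (Subtype.val ⁻¹' weightedHypersimplex r b :
    Set (affineSpan ℝ (weightedHypersimplex r b))))).preimage hcont
  have h1 : (1 : ℝ) ∈ γ ⁻¹' interior (Subtype.val ⁻¹' weightedHypersimplex r b) := by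
    have : γ 1 = y' := Subtype.ext (by simp [γ, x])
    rwa [Set.mem_preimage, this]
  obtain ⟨ε, hε, hball⟩ := Metric.isOpen_iff.1 hopen 1 h1
  have h2 : (1 + ε / 2) ∈ Metric.ball (1 : ℝ) ε := by
    rw [Metric.mem_ball, Real.dist_eq, add_sub_cancel_left, abs_of_pos (by positivity)]
    linarith
  have h3 : s + (1 + ε / 2) • (x - s) ∈ weightedHypersimplex r b :=
    interior_subset (s := Subtype.val ⁻¹' weightedHypersimplex r b) (hball h2)
  have h4 := h3.1 i
  simp only [Pi.add_apply, Pi.smul_apply, Pi.sub_apply, smul_eq_mul] at h4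
  have := hs0 i
  have := hsb i
  change 0 < x i ∧ x i < b i
  constructor <;> by_contra! hcon
  · nlinarith
  · nlinarith

end Polytope

/-! ### Homogeneous coordinates and the torus -/

section Coordinates

variable {k : Type*} [Field k] {r n : ℕ}

@[simp] theorem coord_inl (x : UniversalFamily k r n) (i : Fin n) :
    x.coord (Sum.inl i) = x.point.rep i := rfl

@[simp] theorem coord_inr (x : UniversalFamily k r n) (I : PluckerIndex r n) :
    x.coord (Sum.inr I) = plucker x.space I := rfl

/-- The factor by which `(t, μ, ν)` multiplies a coordinate: `t` acts through the character, and
`μ`, `ν` rescale the two sets of homogeneous coordinates. -/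
def scale (t : Fin n → kˣ) (μ ν : kˣ) (j : Coord r n) : kˣ :=
  (∏ i, t i ^ character r n j i) * μ ^ (bidegree r n j).1 * ν ^ (bidegree r n j).2

@[simp] theorem scale_inl (t : Fin n → kˣ) (μ ν : kˣ) (i : Fin n) :
    scale (r := r) t μ ν (Sum.inl i) = t i * μ := by
  rw [scale, Finset.prod_eq_single i]
  · simp [character, bidegree]
  · intro j _ hj; simp [character, hj]
  · simp

@[simp] theorem scale_inr (t : Fin n → kˣ) (μ ν : kˣ) (I : PluckerIndex r n) :
    scale t μ ν (Sum.inr I) = (∏ i ∈ I.1, t i) * ν := by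
  simp [scale, character, bidegree, pow_ite, Finset.prod_ite_mem]

theorem weight_apply_fintype {M : Type*} [AddCommMonoid M] (w : Coord r n → M)
    (u : Coord r n →₀ ℕ) : Finsupp.weight w u = ∑ j, u j • w j := by
  rw [Finsupp.weight_apply, Finsupp.sum_fintype _ _ (by simp)]

theorem weight_character (u : Coord r n →₀ ℕ) (i : Fin n) :
    Finsupp.weight (character r n) u i = ∑ j, u j * character r n j i := by
  simp [weight_apply_fintype, -Fintype.sum_sum_type]

theorem weight_bidegree_snd (u : Coord r n →₀ ℕ) :
    (Finsupp.weight (bidegree r n) u).2 = ∑ I, u (Sum.inr I) := by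
  rw [weight_apply_fintype, Prod.snd_sum, Fintype.sum_sum_type]
  simp [bidegree]

theorem sum_character (j : Coord r n) :
    ∑ i, character r n j i = (bidegree r n j).1 + r * (bidegree r n j).2 := by
  rcases j with i | I
  · simp [character, bidegree]
  · simp [character, bidegree, I.2]

/-- The character and the Plücker degree determine the degree in the `z i`; hence
`IsInvariantExponent` need not mention the latter. -/
theorem sum_weight_character (u : Coord r n →₀ ℕ) :
    ∑ i, Finsupp.weight (character r n) u i =
      (Finsupp.weight (bidegree r n) u).1 + r * (Finsupp.weight (bidegree r n) u).2 := by
  simp only [weight_character]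
  rw [Finset.sum_comm, weight_apply_fintype, Prod.fst_sum, Prod.snd_sum, Finset.mul_sum,
    ← Finset.sum_add_distrib]
  refine Finset.sum_congr rfl fun j _ => ?_
  rw [← Finset.mul_sum, sum_character]
  simp
  ring

theorem prod_scale_pow (t : Fin n → kˣ) (μ ν : kˣ) (u : Coord r n →₀ ℕ) :
    ∏ j, scale t μ ν j ^ u j = (∏ i, t i ^ Finsupp.weight (character r n) u i) *
      μ ^ (Finsupp.weight (bidegree r n) u).1 * ν ^ (Finsupp.weight (bidegree r n) u).2 := by
  simp only [scale, mul_pow, Finset.prod_mul_distrib]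
  congr 1
  · congr 1
    · simp only [← Finset.prod_pow]
      rw [Finset.prod_comm]
      refine Finset.prod_congr rfl fun i _ => ?_
      rw [weight_character, ← Finset.prod_pow_eq_pow_sum]
      exact Finset.prod_congr rfl fun j _ => by rw [← pow_mul, mul_comm]
    · rw [weight_apply_fintype, Prod.fst_sum, ← Finset.prod_pow_eq_pow_sum]
      exact Finset.prod_congr rfl fun j _ => by
        rw [← pow_mul, Prod.smul_fst, smul_eq_mul, mul_comm]
  · rw [weight_apply_fintype, Prod.snd_sum, ← Finset.prod_pow_eq_pow_sum]
    exact Finset.prod_congr rfl fun j _ => by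
      rw [← pow_mul, Prod.smul_snd, smul_eq_mul, mul_comm]

/-- Whether a bihomogeneous polynomial vanishes does not depend on the choice of homogeneous
coordinates. -/
theorem aeval_scale_one (F : MvPolynomial (Coord r n) k) {d : ℕ × ℕ}
    (hF : MvPolynomial.IsWeightedHomogeneous (bidegree r n) F d) (μ ν : kˣ) (c : Coord r n → k) :
    MvPolynomial.aeval (fun j => (scale 1 μ ν j : k) * c j) F =
      (μ ^ d.1 * ν ^ d.2 : kˣ) * MvPolynomial.aeval c F := by
  rw [MvPolynomial.aeval_def, MvPolynomial.aeval_def, MvPolynomial.eval₂_eq',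
    MvPolynomial.eval₂_eq', Finset.mul_sum]
  refine Finset.sum_congr rfl fun u hu => ?_
  have h1 : (∏ j, ((scale 1 μ ν j : kˣ) : k) ^ u j) = ((μ ^ d.1 * ν ^ d.2 : kˣ) : k) := by
    have := prod_scale_pow (1 : Fin n → kˣ) μ ν u
    rw [hF (MvPolynomial.mem_support_iff.1 hu)] at this
    simp only [Pi.one_apply, one_pow, Finset.prod_const_one, one_mul] at this
    rw [← this]
    push_cast
    rfl
  simp only [mul_pow, Finset.prod_mul_distrib]
  rw [h1]
  ring

theorem minors_smul (t : Fin n → kˣ) (w : Fin r → Fin n → k) (I : PluckerIndex r n) :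
    minors (fun a => t • w a) I = ((∏ i ∈ I.1, t i : kˣ) : k) * minors w I := by
  have h1 : ((∏ i ∈ I.1, t i : kˣ) : k) = ∏ c, (t (I.1.orderEmbOfFin I.2 c) : k) := by
    conv_lhs => rw [← Finset.map_orderEmbOfFin_univ I.1 I.2]
    rw [Finset.prod_map]
    push_cast
    rfl
  rw [h1, minors, minors, ← Matrix.det_mul_row]
  congr 1

theorem smul_mem_smul_space (t : Fin n → kˣ) (V : Submodule k (Fin n → k)) {v : Fin n → k}
    (hv : v ∈ V) : t • v ∈ t • V := Submodule.smul_mem_pointwise_smul v t V hv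

theorem linearIndependent_smul (t : Fin n → kˣ) {w : Fin r → Fin n → k}
    (hw : LinearIndependent k w) : LinearIndependent k fun a => t • w a :=
  hw.map' ((DistribMulAction.toLinearEquiv k (Fin n → k) t) : (Fin n → k) →ₗ[k] (Fin n → k))
    (LinearEquiv.ker _)

theorem linearIndependent_finBasis (V : Gr k r n) : LinearIndependent k
    fun a => ((Module.finBasisOfFinrankEq k V.1 V.2 a : V.1) : Fin n → k) :=
  (Module.finBasisOfFinrankEq k V.1 V.2).linearIndependent.map' V.1.subtype V.1.ker_subtype

/-- The scalars `μ` and `ν` absorb the arbitrary choices of representative and basis in `coord`. -/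
theorem coord_smul (t : Fin n → kˣ) (x : UniversalFamily k r n) :
    ∃ μ ν : kˣ, ∀ j, (t • x).coord j = scale t μ ν j * x.coord j := by
  have hp : ∃ μ : kˣ, (t • x).point.rep = μ • t • x.point.rep := by
    have h1 : (t • x).point = t • x.point := rfl
    conv in (t • x).point => rw [h1, ← x.point.mk_rep]
    rw [Projectivization.smul_mk]
    obtain ⟨a, ha⟩ := Projectivization.exists_smul_eq_mk_rep k (t • x.point.rep)
      ((smul_ne_zero_iff_ne t).2 x.point.rep_nonzero)
    exact ⟨a, ha.symm⟩
  obtain ⟨μ, hμ⟩ := hp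
  obtain ⟨c, hc, hw⟩ := exists_minors_eq (t • x).space
    (fun a => smul_mem_smul_space t x.space.1 (Subtype.prop _))
    (linearIndependent_smul t (linearIndependent_finBasis x.space))
  refine ⟨μ, (Units.mk0 c hc)⁻¹, ?_⟩
  rintro (i | I)
  · rw [coord_inl, hμ, scale_inl, coord_inl]
    simp only [Pi.smul_apply, Pi.smul_apply', Units.smul_def, smul_eq_mul, Units.val_mul]
    ring
  · have := hw I
    rw [minors_smul] at this
    change _ * plucker x.space I = _ at this
    rw [coord_inr, scale_inr, coord_inr, Units.val_mul, Units.val_inv_eq_inv_val, Units.val_mk0,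
      mul_right_comm, this, mul_right_comm, mul_inv_cancel₀ hc, one_mul]

/-- Points with the same coordinates up to `(t, μ, ν)` differ by `t`. -/
theorem eq_smul_of_coord {x y : UniversalFamily k r n} (t : Fin n → kˣ) (μ ν : kˣ)
    (h : ∀ j, y.coord j = scale t μ ν j * x.coord j) (I : PluckerIndex r n)
    (hI : plucker y.space I ≠ 0) : y = t • x := by
  obtain ⟨μ', ν', h'⟩ := coord_smul t x
  refine UniversalFamily.ext ?_ ?_
  · rw [← y.point.mk_rep, ← (t • x).point.mk_rep, Projectivization.mk_eq_mk_iff']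
    refine ⟨(μ / μ' : kˣ), funext fun i => ?_⟩
    have h1 := h (Sum.inl i)
    have h2 := h' (Sum.inl i)
    rw [coord_inl, scale_inl, coord_inl] at h1 h2
    rw [Pi.smul_apply, h1, h2, smul_eq_mul, ← mul_assoc, ← Units.val_mul]
    congr 2
    rw [div_mul_eq_mul_div, div_eq_iff_eq_mul]
    ac_rfl
  · refine (eq_of_plucker_eq (c := ((ν / ν' : kˣ) : k)) (fun I => ?_) I hI).symm
    have h1 := h (Sum.inr I)
    have h2 := h' (Sum.inr I)
    rw [coord_inr, scale_inr, coord_inr] at h1 h2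
    rw [h1, h2, ← mul_assoc, ← Units.val_mul]
    congr 2
    rw [div_mul_eq_mul_div, eq_div_iff_mul_eq']
    ac_rfl

end Coordinates

/-! ### Semistability and invariant monomials -/

section Semistable

variable {k : Type*} [Field k] {r n : ℕ}

/-- `u` is the exponent of an invariant monomial of degree `N` in the Plücker coordinates. -/
def IsInvariantExponent (b : Fin n → ℚ) (N : ℕ) (u : Coord r n →₀ ℕ) : Prop :=
  (∀ i, (Finsupp.weight (character r n) u i : ℚ) = N * b i) ∧
    (Finsupp.weight (bidegree r n) u).2 = N

theorem IsInvariantExponent.bidegree_fst {b : Fin n → ℚ} {N : ℕ} {u : Coord r n →₀ ℕ}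
    (h : IsInvariantExponent b N u) :
    ((Finsupp.weight (bidegree r n) u).1 : ℚ) = N * (∑ i, b i - r) := by
  have h1 : ((∑ i, Finsupp.weight (character r n) u i : ℕ) : ℚ) = N * ∑ i, b i := by
    push_cast
    rw [Finset.mul_sum]
    exact Finset.sum_congr rfl fun i _ => h.1 i
  rw [sum_weight_character, h.2] at h1
  push_cast at h1
  linarith

/-- A nonvanishing section has a nonvanishing monomial. Conversely, a monomial with coefficient 1 is
defined over every base ring, so semistability does not depend on `A`. -/
theorem isSemistable_iff_exponent (A : Type*) [CommRing A] [Algebra A k] (b : Fin n → ℚ)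
    (x : UniversalFamily k r n) : IsSemistable A b x ↔ ∃ (N : ℕ) (u : Coord r n →₀ ℕ), 0 < N ∧
      IsInvariantExponent b N u ∧ ∀ j, x.coord j = 0 → u j = 0 := by
  constructor
  · rintro ⟨N, s, hN, ⟨a, c, -, hc, hdeg, hchar⟩, hs⟩
    rw [MvPolynomial.aeval_def, MvPolynomial.eval₂_eq'] at hs
    obtain ⟨u, hu, hne⟩ := Finset.exists_ne_zero_of_sum_ne_zero hs
    rw [MvPolynomial.mem_support_iff] at hu
    refine ⟨N, u, hN, ⟨fun i => ?_, ?_⟩, fun j hj => ?_⟩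
    · rw [hchar hu, hc]
    · rw [hdeg hu]
    · by_contra h0
      refine right_ne_zero_of_mul hne (Finset.prod_eq_zero (Finset.mem_univ j) ?_)
      rw [hj, zero_pow h0]
  · rintro ⟨N, u, hN, hu, hsupp⟩
    refine ⟨N, MvPolynomial.monomial u 1, hN, ⟨(Finsupp.weight (bidegree r n) u).1,
      Finsupp.weight (character r n) u, hu.bidegree_fst, hu.1,
      MvPolynomial.isWeightedHomogeneous_monomial _ _ _ (Prod.ext rfl hu.2),
      MvPolynomial.isWeightedHomogeneous_monomial _ _ _ rfl⟩, ?_⟩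
    rw [MvPolynomial.aeval_monomial, map_one, one_mul]
    refine Finset.prod_ne_zero_iff.2 fun j hj => pow_ne_zero _ fun h0 => ?_
    exact (Finsupp.mem_support_iff.1 hj) (hsupp j h0)

/-- A finite set of positive reals can be mapped to positive rationals by a `ℚ`-linear map. -/
theorem exists_linearMap_pos (F : Finset ℝ) (hF : ∀ x ∈ F, 0 < x) :
    ∃ φ : ℝ →ₗ[ℚ] ℚ, ∀ x ∈ F, 0 < φ x := by
  let B := Module.Basis.ofVectorSpace ℚ ℝ
  -- `f x s` is the value at `x` of the `ℚ`-linear map sending the basis vectors to `s`. Positivity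
  -- on `F` is an open condition on `s` that holds for the identity map, so it also holds for some
  -- rational `s`.
  let f : ℝ → (Module.Basis.ofVectorSpaceIndex ℚ ℝ → ℝ) → ℝ := fun x s =>
    ∑ j ∈ (B.repr x).support, ((B.repr x j : ℚ) : ℝ) * s j
  have hopen : IsOpen (⋂ x ∈ F, f x ⁻¹' Set.Ioi 0) :=
    isOpen_biInter_finset fun x _ => isOpen_Ioi.preimage (by fun_prop)
  have hne : (⋂ x ∈ F, f x ⁻¹' Set.Ioi 0).Nonempty := by
    refine ⟨fun j => B j, Set.mem_iInter₂.2 fun x hx => ?_⟩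
    have : f x (fun j => B j) = x := by
      conv_rhs => rw [← B.linearCombination_repr x, Finsupp.linearCombination_apply, Finsupp.sum]
      exact Finset.sum_congr rfl fun j _ => (Rat.smul_def _ _).symm
    rw [Set.mem_preimage, this]
    exact hF x hx
  have hdense : DenseRange (Pi.map fun (_ : Module.Basis.ofVectorSpaceIndex ℚ ℝ) (q : ℚ) => (q : ℝ)) :=
    DenseRange.piMap fun _ => Rat.denseRange_cast
  obtain ⟨_, hq, q, rfl⟩ := hdense.inter_open_nonempty _ hopen hne
  refine ⟨B.constr ℚ q, fun x hx => ?_⟩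
  have h1 : 0 < f x _ := Set.mem_iInter₂.1 hq x hx
  have h2 : f x (Pi.map (fun _ (q : ℚ) => (q : ℝ)) q) = ((B.constr ℚ q x : ℚ) : ℝ) := by
    rw [Module.Basis.constr_apply, Finsupp.sum]
    push_cast [smul_eq_mul]
    rfl
  rw [h2] at h1
  exact_mod_cast h1

/-- A real solution of the equations for invariant exponents yields an integral one with the same
support. -/
theorem exists_invariantExponent (b : Fin n → ℚ) (ρ : Coord r n → ℝ) (h0 : ∀ j, 0 ≤ ρ j)
    (hchar : ∀ i, ∑ j, ρ j * character r n j i = b i) (hdeg : ∑ I, ρ (Sum.inr I) = 1) :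
    ∃ (N : ℕ) (u : Coord r n →₀ ℕ), 0 < N ∧ IsInvariantExponent b N u ∧
      ∀ j, u j = 0 ↔ ρ j = 0 := by
  classical
  obtain ⟨φ, hφ⟩ := exists_linearMap_pos (insert 1 ((Finset.univ.image ρ).filter (0 < ·))) (by
    intro x hx
    rcases Finset.mem_insert.1 hx with rfl | hx
    · exact one_pos
    · exact (Finset.mem_filter.1 hx).2)
  have hφ1 : 0 < φ 1 := hφ 1 (Finset.mem_insert_self _ _)
  have hφpos : ∀ j, 0 < ρ j → 0 < φ (ρ j) := fun j hj => hφ _ (Finset.mem_insert_of_mem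
    (Finset.mem_filter.2 ⟨Finset.mem_image_of_mem ρ (Finset.mem_univ j), hj⟩))
  -- Dividing by `φ 1` makes the linear map fix `ℚ`, so the equations with rational coefficients
  -- persist.
  let q : Coord r n → ℚ := fun j => φ (ρ j) / φ 1
  have hq : ∀ j, q j = 0 ↔ ρ j = 0 := by
    intro j
    refine ⟨fun h => ?_, fun h => by simp [q, h]⟩
    by_contra hne
    have := hφpos j (lt_of_le_of_ne (h0 j) (Ne.symm hne))
    exact (div_pos this hφ1).ne' h
  have hq0 : ∀ j, 0 ≤ q j := by
    intro j
    rcases (h0 j).eq_or_lt with h | h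
    · rw [(hq j).2 h.symm]
    · exact (div_pos (hφpos j h) hφ1).le
  have hqchar : ∀ i, ∑ j, q j * character r n j i = b i := by
    intro i
    have h1 := congrArg φ (hchar i)
    rw [map_sum] at h1
    have h2 : ((b i : ℚ) : ℝ) = b i • (1 : ℝ) := by rw [Rat.smul_def, mul_one]
    rw [h2, map_smul, smul_eq_mul] at h1
    simp only [q, div_mul_eq_mul_div]
    rw [← Finset.sum_div, div_eq_iff hφ1.ne', ← h1]
    refine Finset.sum_congr rfl fun j _ => ?_
    rw [mul_comm (ρ j), ← nsmul_eq_mul, map_nsmul, nsmul_eq_mul, mul_comm]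
  have hqdeg : ∑ I, q (Sum.inr I) = 1 := by
    have h1 := congrArg φ hdeg
    rw [map_sum] at h1
    simp only [q]
    rw [← Finset.sum_div, h1, div_self hφ1.ne']
  let N : ℕ := ∏ j, (q j).den
  have hN : 0 < N := Finset.prod_pos fun j _ => (q j).den_pos
  have hm : ∀ j, ∃ m : ℕ, (m : ℚ) = N * q j := by
    intro j
    obtain ⟨d, hd⟩ : (q j).den ∣ N := Finset.dvd_prod_of_mem _ (Finset.mem_univ j)
    refine ⟨d * (q j).num.toNat, ?_⟩
    have h1 : (((q j).num.toNat : ℤ) : ℚ) = (q j).num := by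
      rw [Int.toNat_of_nonneg (Rat.num_nonneg.2 (hq0 j))]
    rw [hd]
    push_cast at h1 ⊢
    rw [h1, mul_comm ((q j).den : ℚ), mul_assoc, Rat.den_mul_eq_num]
  choose m hm using hm
  refine ⟨N, Finsupp.equivFunOnFinite.symm m, hN, ⟨fun i => ?_, ?_⟩, fun j => ?_⟩
  · rw [weight_character]
    simp only [Finsupp.equivFunOnFinite_symm_apply_apply]
    rw [Nat.cast_sum, ← hqchar i, Finset.mul_sum]
    refine Finset.sum_congr rfl fun j _ => ?_
    rw [Nat.cast_mul, hm, mul_assoc]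
  · rw [weight_bidegree_snd]
    simp only [Finsupp.equivFunOnFinite_symm_apply_apply]
    have : ((∑ I, m (Sum.inr I) : ℕ) : ℚ) = N := by
      rw [Nat.cast_sum]
      simp only [hm]
      rw [← Finset.mul_sum, hqdeg, mul_one]
    exact_mod_cast this
  · rw [← hq, Finsupp.equivFunOnFinite_symm_apply_apply, ← Nat.cast_eq_zero (R := ℚ), hm, mul_eq_zero]
    have : (N : ℚ) ≠ 0 := by exact_mod_cast hN.ne'
    tauto

theorem sum_mul_character (ρ : Coord r n → ℝ) (i : Fin n) :
    ∑ j, ρ j * character r n j i =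
      ρ (Sum.inl i) + (∑ I, ρ (Sum.inr I) • indicatorPoint I) i := by
  rw [Fintype.sum_sum_type, Finset.sum_apply]
  congr 1
  · rw [Finset.sum_eq_single i]
    · simp [character]
    · intro j _ hj; simp [character, hj.symm]
    · simp
  · refine Finset.sum_congr rfl fun I _ => ?_
    simp [character, indicatorPoint]

/-- Semistability in terms of the matroid polytope. -/
theorem isSemistable_iff (A : Type*) [CommRing A] [Algebra A k] (b : Fin n → ℚ)
    (x : UniversalFamily k r n) : IsSemistable A b x ↔ ∃ y ∈ matroidPolytope x.space,
      (∀ i, y i ≤ b i) ∧ ∀ i, x.point.rep i = 0 → y i = b i := by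
  rw [isSemistable_iff_exponent]
  constructor
  · rintro ⟨N, u, hN, ⟨hchar, hdeg⟩, hu⟩
    have hN' : (0 : ℝ) < N := by exact_mod_cast hN
    let ρ : Coord r n → ℝ := fun j => u j / N
    have h1 : ∀ i, ρ (Sum.inl i) + (∑ I, ρ (Sum.inr I) • indicatorPoint I) i = b i := by
      intro i
      rw [← sum_mul_character]
      have h2 : ((Finsupp.weight (character r n) u i : ℕ) : ℝ) = N * b i := by
        exact_mod_cast congrArg (Rat.cast : ℚ → ℝ) (hchar i)
      rw [weight_character] at h2
      simp only [ρ, div_mul_eq_mul_div]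
      rw [← Finset.sum_div, div_eq_iff hN'.ne', mul_comm, ← h2]
      push_cast
      rfl
    have hρ : ∀ j, 0 ≤ ρ j := fun j => by positivity
    refine ⟨∑ I, ρ (Sum.inr I) • indicatorPoint I, mem_matroidPolytope.2 ⟨fun I => ρ (Sum.inr I),
      fun I => hρ _, fun I hI h0 => hI ?_, ?_, rfl⟩, fun i => ?_, fun i hi => ?_⟩
    · simp [ρ, hu (Sum.inr I) h0]
    · simp only [ρ]
      rw [← Finset.sum_div, ← Nat.cast_sum, ← weight_bidegree_snd, hdeg, div_self hN'.ne']
    · linarith [h1 i, hρ (Sum.inl i)]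
    · have : ρ (Sum.inl i) = 0 := by simp [ρ, hu (Sum.inl i) hi]
      linarith [h1 i]
  · rintro ⟨y, hy, hle, heq⟩
    obtain ⟨c, hc0, hcV, hc1, rfl⟩ := mem_matroidPolytope.1 hy
    -- The slack `b i - y i` becomes the exponent of `z i`, and the convex weights become those of
    -- the `p_I`.
    obtain ⟨N, u, hN, hu, hsupp⟩ := exists_invariantExponent b
      (Sum.elim (fun i => b i - (∑ I, c I • indicatorPoint I) i) c)
      (by rintro (i | I)
          · exact sub_nonneg.2 (hle i)
          · exact hc0 I)
      (by intro i; rw [sum_mul_character]; simp) (by simpa using hc1)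
    refine ⟨N, u, hN, hu, ?_⟩
    rintro (i | I) h
    · exact (hsupp _).2 (sub_eq_zero.2 (heq i h).symm)
    · exact (hsupp _).2 (by_contra fun h2 => hcV I h2 h)

end Semistable

/-! ### Semistability and log canonicity -/

section LogCanonical

variable {k : Type*} [Field k] {r n : ℕ}

theorem rep_mem (x : UniversalFamily k r n) : x.point.rep ∈ x.space.1 := by
  have := x.point_mem
  rwa [Projectivization.submodule_eq, Submodule.span_singleton_le_iff_mem] at this

theorem point_le_intersection_iff (x : UniversalFamily k r n) (C : Finset (Fin n)) :
    x.point.submodule ≤ intersection x.space C ↔ ∀ i ∈ C, x.point.rep i = 0 := by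
  rw [Projectivization.submodule_eq, Submodule.span_singleton_le_iff_mem, mem_intersection]
  exact and_iff_right (rep_mem x)

theorem codim_singleton_of_le {V : Gr k r n} {i : Fin n} (h : V.1 ≤ coordHyperplane k i) :
    codim V {i} = 0 := by
  have : intersection V {i} = V.1 := by
    ext v
    rw [mem_intersection]
    refine ⟨And.left, fun hv => ⟨hv, fun j hj => ?_⟩⟩
    rw [Finset.mem_singleton.1 hj]
    exact h hv
  rw [codim, this, sub_self]

/-- The divisor condition is automatic: if `V` lies in a coordinate hyperplane, the inequality for
that single index reads `b i ≤ 0`. -/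
theorem isLCAt_iff {b : Fin n → ℚ} (hb : ∀ i, 0 < b i) (x : UniversalFamily k r n) :
    IsLCAt b x ↔ ∀ C : Finset (Fin n), C.Nonempty → (∀ i ∈ C, x.point.rep i = 0) →
      ∑ i ∈ C, b i ≤ codim x.space C := by
  constructor
  · exact fun h C hC hz => h.2 C hC ((point_le_intersection_iff x C).2 hz)
  · refine fun h => ⟨fun i _ hi => ?_, fun C hC hz => h C hC ((point_le_intersection_iff x C).1 hz)⟩
    have := h {i} (Finset.singleton_nonempty i) fun j hj => by
      rw [Finset.mem_singleton.1 hj]; exact hi (rep_mem x)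
    rw [Finset.sum_singleton, codim_singleton_of_le hi] at this
    exact (hb i).not_ge this

theorem isKLTAt_iff {b : Fin n → ℚ} (hb : ∀ i, 0 < b i) (x : UniversalFamily k r n) :
    IsKLTAt b x ↔ ∀ C : Finset (Fin n), C.Nonempty → (∀ i ∈ C, x.point.rep i = 0) →
      ∑ i ∈ C, b i < codim x.space C := by
  constructor
  · exact fun h C hC hz => h.2 C hC ((point_le_intersection_iff x C).2 hz)
  · refine fun h => ⟨fun i _ hi => ?_, fun C hC hz => h C hC ((point_le_intersection_iff x C).1 hz)⟩
    have := h {i} (Finset.singleton_nonempty i) fun j hj => by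
      rw [Finset.mem_singleton.1 hj]; exact hi (rep_mem x)
    rw [Finset.sum_singleton, codim_singleton_of_le hi] at this
    exact (hb i).not_gt this

theorem not_isSemistable (A : Type*) [CommRing A] [Algebra A k] {b : Fin n → ℚ}
    (hb : ∀ i, 0 < b i) (x : UniversalFamily k r n)
    (h : matroidPolytope x.space ∩ weightedHypersimplex r b = ∅ ∨
      ∃ i, x.space.1 ≤ coordHyperplane k i) : ¬ IsSemistable A b x := by
  rw [isSemistable_iff]
  rintro ⟨y, hy, hle, heq⟩
  rcases h with h | ⟨i, hi⟩
  · have : y ∈ matroidPolytope x.space ∩ weightedHypersimplex r b :=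
      ⟨hy, fun i => ⟨nonneg_of_mem_matroidPolytope hy i, hle i⟩, sum_eq_of_mem_matroidPolytope hy⟩
    rw [h] at this
    exact this
  · have h1 := sum_le_codim hy {i}
    rw [Finset.sum_singleton, codim_singleton_of_le hi, heq i (hi (rep_mem x))] at h1
    exact (hb i).not_ge (by exact_mod_cast h1)

theorem isSemistable_iff_isLCAt (A : Type*) [CommRing A] [Algebra A k] {b : Fin n → ℚ}
    (hb : ∀ i, 0 < b i) (x : UniversalFamily k r n)
    (h : (matroidPolytope x.space ∩ weightedHypersimplex r b).Nonempty) :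
    IsSemistable A b x ↔ IsLCAt b x := by
  classical
  rw [isSemistable_iff, isLCAt_iff hb]
  constructor
  · rintro ⟨y, hy, hle, heq⟩ C - hz
    have h1 := sum_le_codim hy C
    rw [Finset.sum_congr rfl fun i hi => heq i (hz i hi)] at h1
    exact_mod_cast h1
  · intro hC
    obtain ⟨y, hy, hyΔ⟩ := h
    obtain ⟨y', hy', hle, heq⟩ := exists_le_and_eqOn x.space (fun i => (b i : ℝ))
      (Finset.univ.filter fun i => x.point.rep i = 0) ⟨y, hy, fun i => (hyΔ.1 i).2⟩
      fun C hCZ hne => by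
        exact_mod_cast hC C hne fun i hi => (Finset.mem_filter.1 (hCZ hi)).2
    exact ⟨y', hy', hle, fun i hi => heq i (Finset.mem_filter.2 ⟨Finset.mem_univ i, hi⟩)⟩

end LogCanonical

/-! ### Degenerations: stable points are Kawamata log terminal -/

section Degeneration

variable {k : Type*} [Field k] {r n : ℕ}

theorem infinite_units [Infinite k] : Infinite kˣ := by
  rw [← not_finite_iff_infinite]
  intro h
  have h1 : (Set.range ((↑) : kˣ → k)).Finite := Set.finite_range _
  have h2 : (Set.univ : Set k) ⊆ insert 0 (Set.range ((↑) : kˣ → k)) := by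
    intro c _
    by_cases hc : c = 0
    · exact Set.mem_insert_iff.2 (Or.inl hc)
    · exact Set.mem_insert_of_mem _ ⟨Units.mk0 c hc, rfl⟩
  exact Set.infinite_univ ((h1.insert 0).subset h2)

theorem IsSemistable.smul {A : Type*} [CommRing A] [Algebra A k] {b : Fin n → ℚ}
    {x : UniversalFamily k r n} (hx : IsSemistable A b x) (t : Fin n → kˣ) :
    IsSemistable A b (t • x) := by
  rw [isSemistable_iff_exponent] at hx ⊢
  obtain ⟨N, u, hN, hu, hsupp⟩ := hx
  obtain ⟨μ, ν, h⟩ := coord_smul t x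
  refine ⟨N, u, hN, hu, fun j hj => hsupp j ?_⟩
  rw [h, mul_eq_zero] at hj
  exact hj.resolve_left (Units.ne_zero _)

/-- Bihomogeneous polynomials may be evaluated at any homogeneous coordinates. -/
theorem aeval_ne_zero_iff (y : UniversalFamily k r n) (z : Fin n → k) (hz : ∃ μ : kˣ, z = μ • y.point.rep)
    (w : Fin r → Fin n → k) (hw : ∀ a, w a ∈ y.space.1) (hli : LinearIndependent k w)
    {F : MvPolynomial (Coord r n) k} {d : ℕ × ℕ}
    (hF : MvPolynomial.IsWeightedHomogeneous (bidegree r n) F d) :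
    MvPolynomial.aeval (Sum.elim z (minors w)) F ≠ 0 ↔ MvPolynomial.aeval y.coord F ≠ 0 := by
  obtain ⟨μ, rfl⟩ := hz
  obtain ⟨c, hc, h⟩ := exists_minors_eq y.space hw hli
  have : (Sum.elim (μ • y.point.rep) (minors w) : Coord r n → k) =
      fun j => (scale 1 μ (Units.mk0 c hc) j : k) * y.coord j := by
    funext j
    rcases j with i | I
    · simp [Units.smul_def]
    · simp [h]
  rw [this, aeval_scale_one F hF, mul_ne_zero_iff]
  exact and_iff_right (Units.ne_zero _)

/-- The one-parameter subgroup with weight `0` on `C` and weight `1` off `C`. -/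
def oneParameter (C : Finset (Fin n)) (τ : kˣ) : Fin n → kˣ := fun i => if i ∈ C then 1 else τ

/-! ### Degeneration of `V` along a one-parameter subgroup -/

variable (V : Gr k r n) (C : Finset (Fin n))

theorem exists_projection : ∃ P : V.1 →ₗ[k] V.1, (∀ v, P v ∈ LinearMap.ker (restrict V C)) ∧
    ∀ v ∈ LinearMap.ker (restrict V C), P v = v := by
  obtain ⟨g, hg⟩ := LinearMap.exists_leftInverse_of_injective (K := k)
    (V := LinearMap.ker (restrict V C)) (V' := V.1) _ (LinearMap.ker (restrict V C)).ker_subtype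
  refine ⟨(LinearMap.ker (restrict V C)).subtype ∘ₗ g, fun v => (g v).2, fun v hv => ?_⟩
  have := LinearMap.congr_fun hg ⟨v, hv⟩
  exact congrArg Subtype.val this

/-- A projection of `V` onto the vectors of `V` that vanish on `C`. -/
def projection : V.1 →ₗ[k] V.1 := (exists_projection V C).choose

variable {V C}

theorem mem_ker_restrict {v : V.1} :
    v ∈ LinearMap.ker (restrict V C) ↔ ∀ i ∈ C, (v : Fin n → k) i = 0 :=
  ⟨fun h i hi => congrFun (LinearMap.mem_ker.1 h) ⟨i, hi⟩,
    fun h => LinearMap.mem_ker.2 (funext fun i => h i.1 i.2)⟩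

theorem projection_apply_eq_zero (v : V.1) {i : Fin n} (hi : i ∈ C) :
    (projection V C v : Fin n → k) i = 0 :=
  mem_ker_restrict.1 ((exists_projection V C).choose_spec.1 v) i hi

theorem projection_of_vanish {v : V.1} (h : ∀ i ∈ C, (v : Fin n → k) i = 0) :
    projection V C v = v :=
  (exists_projection V C).choose_spec.2 v (mem_ker_restrict.2 h)

variable (V C)

/-- The embedding of `V` whose image is, for `τ ≠ 0`, the translate of `V` under the one-parameter
subgroup, and, for `τ = 0`, the limit of these. -/
def degeneration (τ : k) : V.1 →ₗ[k] (Fin n → k) :=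
  LinearMap.pi fun i => if i ∈ C then LinearMap.proj i ∘ₗ V.1.subtype
    else LinearMap.proj i ∘ₗ V.1.subtype ∘ₗ (projection V C + τ • (LinearMap.id - projection V C))

variable {V C}

theorem degeneration_apply_mem (τ : k) (v : V.1) {i : Fin n} (hi : i ∈ C) :
    degeneration V C τ v i = (v : Fin n → k) i := by
  simp [degeneration, hi]

theorem degeneration_apply_notMem (τ : k) (v : V.1) {i : Fin n} (hi : i ∉ C) :
    degeneration V C τ v i = (projection V C v : Fin n → k) i +
      τ * ((v : Fin n → k) i - (projection V C v : Fin n → k) i) := by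
  simp [degeneration, hi]

theorem degeneration_of_vanish (τ : k) {v : V.1} (h : ∀ i ∈ C, (v : Fin n → k) i = 0) :
    degeneration V C τ v = v := by
  funext i
  by_cases hi : i ∈ C
  · rw [degeneration_apply_mem _ _ hi]
  · rw [degeneration_apply_notMem _ _ hi, projection_of_vanish h, sub_self, mul_zero, add_zero]

/-- Injectivity holds even at `τ = 0`: a vector in the kernel vanishes on `C`, and such vectors are
not moved. -/
theorem ker_degeneration (τ : k) : LinearMap.ker (degeneration V C τ) = ⊥ := by
  rw [LinearMap.ker_eq_bot']
  intro v hv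
  have h : ∀ i ∈ C, (v : Fin n → k) i = 0 := fun i hi => by
    rw [← degeneration_apply_mem τ v hi, hv, Pi.zero_apply]
  rw [degeneration_of_vanish τ h] at hv
  exact Subtype.ext hv

theorem degeneration_mem_smul (τ : kˣ) (v : V.1) :
    degeneration V C τ v ∈ oneParameter C τ • V.1 := by
  have : degeneration V C τ v = oneParameter C τ •
      (((τ⁻¹ : kˣ) : k) • projection V C v + (v - projection V C v) : V.1).1 := by
    funext i
    by_cases hi : i ∈ C
    · rw [degeneration_apply_mem _ _ hi]
      simp [oneParameter, hi, projection_apply_eq_zero v hi]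
    · rw [degeneration_apply_notMem _ _ hi]
      simp [oneParameter, hi, Units.smul_def]
  rw [this]
  exact Submodule.smul_mem_pointwise_smul _ _ _ (Subtype.prop _)

variable (V C) in
/-- The limit of `V` under the one-parameter subgroup: the sum of the vectors of `V` that vanish on
`C` and of the projection of `V` to the coordinates in `C`. -/
def limitSpace : Gr k r n :=
  ⟨LinearMap.range (degeneration V C 0),
    (LinearMap.finrank_range_of_inj (LinearMap.ker_eq_bot.1 (ker_degeneration 0))).trans V.2⟩

/-- When `I ∩ C` has full rank in `C`, vanishing on `I ∩ C` forces vanishing on all of `C`, and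
there the degeneration is the identity. -/
theorem isBase_limitSpace {I : Finset (Fin n)} (hI : IsBase V I)
    (h : ((I ∩ C).card : ℚ) = codim V C) : IsBase (limitSpace V C) I := by
  refine ⟨hI.1, ?_⟩
  rintro _ ⟨v, rfl⟩ hv
  have h1 : intersection V C = intersection V (I ∩ C) := by
    refine Submodule.eq_of_le_of_finrank_eq (fun u hu => ?_) ?_
    · rw [mem_intersection] at hu ⊢
      exact ⟨hu.1, fun i hi => hu.2 i (Finset.mem_inter.1 hi).2⟩
    · rw [← hI.codim_subset Finset.inter_subset_left, codim, codim] at h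
      have h2 : (Module.finrank k (intersection V (I ∩ C)) : ℚ) =
        Module.finrank k (intersection V C) := by linarith
      exact_mod_cast h2.symm
  have h3 : (v : Fin n → k) ∈ intersection V C := by
    rw [h1, mem_intersection]
    refine ⟨v.2, fun i hi => ?_⟩
    rw [← degeneration_apply_mem 0 v (Finset.mem_inter.1 hi).2]
    exact hv i (Finset.mem_inter.1 hi).1
  have h4 := degeneration_of_vanish 0 (mem_intersection.1 h3).2
  rw [h4] at hv ⊢
  exact hI.2 _ v.2 hv

theorem smul_limitSpace_le (σ : kˣ) :
    oneParameter C σ • (limitSpace V C).1 ≤ (limitSpace V C).1 := by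
  rintro _ ⟨_, ⟨v, rfl⟩, rfl⟩
  -- In the limit, `v` contributes its own coordinates on `C` and those of its projection off `C`.
  -- Adding `(σ - 1)` times the projection scales only the latter by `σ`.
  refine ⟨((σ : k) - 1) • projection V C v + v, ?_⟩
  have hp : degeneration V C 0 (projection V C v) = projection V C v :=
    degeneration_of_vanish 0 fun i hi => projection_apply_eq_zero v hi
  rw [map_add, map_smul, hp]
  change _ = oneParameter C σ • degeneration V C 0 v
  funext i
  by_cases hi : i ∈ C
  · rw [Pi.add_apply, Pi.smul_apply, projection_apply_eq_zero v hi]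
    simp [oneParameter, hi]
  · rw [Pi.add_apply, Pi.smul_apply, Pi.smul_apply', degeneration_apply_notMem _ _ hi]
    simp [oneParameter, hi, Units.smul_def, sub_mul]

/-! ### The limit of a point of the universal family -/

variable (x : UniversalFamily k r n) (hC : ∀ i ∈ C, x.point.rep i = 0)

/-- The limit of `x` under the one-parameter subgroup. -/
def limitPoint (x : UniversalFamily k r n) (hC : ∀ i ∈ C, x.point.rep i = 0) :
    UniversalFamily k r n where
  point := x.point
  space := limitSpace x.space C
  point_mem := by
    rw [Projectivization.submodule_eq, Submodule.span_singleton_le_iff_mem]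
    exact ⟨⟨_, rep_mem x⟩, degeneration_of_vanish 0 hC⟩

theorem oneParameter_smul_limitPoint (σ : kˣ) :
    oneParameter C σ • limitPoint x hC = limitPoint x hC := by
  refine UniversalFamily.ext ?_ (Subtype.ext ?_)
  · change oneParameter C σ • x.point = x.point
    rw [← x.point.mk_rep, Projectivization.smul_mk, Projectivization.mk_eq_mk_iff']
    refine ⟨σ, funext fun i => ?_⟩
    by_cases hi : i ∈ C
    · simp [hC i hi]
    · simp [oneParameter, hi, Units.smul_def]
  · exact Submodule.eq_of_le_of_finrank_eq (smul_limitSpace_le σ)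
      ((oneParameter C σ • limitPoint x hC).space.2.trans (limitPoint x hC).space.2.symm)

/-- The same `y` works. It is tight on `C`, so every basis occurring in it meets `C` in as many
elements as possible, and therefore survives in the limit. -/
theorem isSemistable_limitPoint {A : Type*} [CommRing A] [Algebra A k] {b : Fin n → ℚ}
    (hx : IsSemistable A b x) (htight : codim x.space C ≤ ∑ i ∈ C, b i) :
    IsSemistable A b (limitPoint x hC) := by
  rw [isSemistable_iff] at hx ⊢
  obtain ⟨y, hy, hle, heq⟩ := hx
  refine ⟨y, ?_, hle, heq⟩
  have h1 : ∑ i ∈ C, y i = (codim x.space C : ℝ) := by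
    refine le_antisymm (sum_le_codim hy C) ?_
    rw [Finset.sum_congr rfl fun i hi => heq i (hC i hi)]
    exact_mod_cast htight
  obtain ⟨c, hc0, hcV, hc1, rfl⟩ := mem_matroidPolytope.1 hy
  refine mem_matroidPolytope.2 ⟨c, hc0, fun I hI => ?_, hc1, rfl⟩
  have hle' : ∀ I ∈ Finset.univ, c I * ((I.1 ∩ C).card : ℝ) ≤ c I * (codim x.space C : ℝ) := by
    intro I _
    by_cases h : c I = 0
    · simp [h]
    · refine mul_le_mul_of_nonneg_left ?_ (hc0 I)
      exact_mod_cast ((plucker_ne_zero_iff _ I).1 (hcV I h)).card_inter_le C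
  rw [sum_combination, ← one_mul ((codim x.space C : ℚ) : ℝ), ← hc1, Finset.sum_mul,
    Finset.sum_eq_sum_iff_of_le hle'] at h1
  refine (plucker_ne_zero_iff _ I).2
    (isBase_limitSpace ((plucker_ne_zero_iff _ I).1 (hcV I hI)) ?_)
  exact_mod_cast mul_left_cancel₀ hI (h1 I (Finset.mem_univ I))

/-- The translates of `x` under the one-parameter subgroup converge to the limit point. -/
theorem finite_setOf_notMem {O : Set (UniversalFamily k r n)} (hO : IsOpen O)
    (hmem : limitPoint x hC ∈ O) : {τ : kˣ | oneParameter C τ • x ∉ O}.Finite := by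
  induction hO with
  | basic W hW =>
    obtain ⟨d, F, hF, rfl⟩ := hW
    let B := Module.finBasisOfFinrankEq k x.space.1 x.space.2
    let w : k → Fin r → Fin n → k := fun τ a => degeneration x.space C τ (B a)
    have hli : ∀ τ, LinearIndependent k (w τ) := fun τ =>
      B.linearIndependent.map' (degeneration x.space C τ) (ker_degeneration τ)
    let E : Fin r → Fin n → Polynomial k := fun a i =>
      if i ∈ C then Polynomial.C ((B a : Fin n → k) i) else
        Polynomial.C ((projection x.space C (B a) : Fin n → k) i) + Polynomial.X *
          Polynomial.C ((B a : Fin n → k) i - (projection x.space C (B a) : Fin n → k) i)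
    have hE : ∀ τ a i, (E a i).eval τ = w τ a i := by
      intro τ a i
      by_cases hi : i ∈ C
      · simp only [E, w, if_pos hi, Polynomial.eval_C]
        rw [degeneration_apply_mem _ _ hi]
      · simp only [E, w, if_neg hi, Polynomial.eval_add, Polynomial.eval_mul, Polynomial.eval_C,
          Polynomial.eval_X]
        rw [degeneration_apply_notMem _ _ hi]
    -- Along the degeneration `F` becomes a polynomial in `τ`, nonzero at `τ = 0`. Outside its
    -- finitely many roots the translate lies in the basic open set.
    let G : Polynomial k := MvPolynomial.aeval
      (Sum.elim (fun i => Polynomial.C (x.point.rep i)) fun I : PluckerIndex r n =>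
        Matrix.det (Matrix.of fun a c : Fin r => E a (I.1.orderEmbOfFin I.2 c))) F
    have hG : ∀ τ, G.eval τ = MvPolynomial.aeval (Sum.elim x.point.rep (minors (w τ))) F := by
      intro τ
      rw [← Polynomial.coe_aeval_eq_eval, MvPolynomial.comp_aeval_apply]
      congr 2
      funext j
      rcases j with i | I
      · simp
      · rw [Sum.elim_inr, Sum.elim_inr, Polynomial.coe_aeval_eq_eval, ← Polynomial.coe_evalRingHom,
          RingHom.map_det, minors]
        congr 1
        ext a c
        exact hE τ a _
    have hG0 : G.eval 0 ≠ 0 := by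
      rw [hG]
      exact (aeval_ne_zero_iff (limitPoint x hC) _ ⟨1, (one_smul _ _).symm⟩ _
        (fun a => ⟨B a, rfl⟩) (hli 0) hF).2 hmem
    have hGne : G ≠ 0 := by
      rintro h
      rw [h, Polynomial.eval_zero] at hG0
      exact hG0 rfl
    refine ((Polynomial.finite_setOfPred_isRoot hGne).preimage
      (Units.val_injective.injOn (s := (fun τ : kˣ => (τ : k)) ⁻¹' {τ | G.IsRoot τ}))).subset ?_
    intro τ hτ
    by_contra hroot
    refine hτ ((aeval_ne_zero_iff (oneParameter C τ • x) x.point.rep ?_ _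
      (fun a => degeneration_mem_smul τ (B a)) (hli τ) hF).1 ?_)
    · obtain ⟨μ, ν, h⟩ := coord_smul (oneParameter C τ) x
      refine ⟨(τ * μ)⁻¹, ?_⟩
      rw [eq_inv_smul_iff]
      funext i
      have := h (Sum.inl i)
      rw [coord_inl, scale_inl, coord_inl] at this
      rw [this]
      by_cases hi : i ∈ C
      · simp [hC i hi]
      · simp [oneParameter, hi, Units.smul_def]
    · rw [← hG]
      exact hroot
  | univ => simp
  | inter O₁ O₂ _ _ h₁ h₂ =>
    refine ((h₁ hmem.1).union (h₂ hmem.2)).subset fun τ hτ => ?_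
    by_contra hcon
    refine hτ ⟨?_, ?_⟩ <;> by_contra h
    · exact hcon (Or.inl h)
    · exact hcon (Or.inr h)
  | sUnion S _ h =>
    obtain ⟨O, hOS, hO⟩ := hmem
    exact (h O hOS hO).subset fun τ hτ hmem' => hτ ⟨O, hOS, hmem'⟩

theorem mem_orbit_torus {x y : UniversalFamily k r n} :
    y ∈ MulAction.orbit (Torus k n) x ↔ ∃ t : Fin n → kˣ, y = t • x := by
  constructor
  · rintro ⟨g, rfl⟩
    obtain ⟨t, rfl⟩ := QuotientGroup.mk_surjective g
    exact ⟨t, rfl⟩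
  · rintro ⟨t, rfl⟩
    exact ⟨(t : Torus k n), rfl⟩

theorem isKLTAt_of_isStable [Infinite k] (A : Type*) [CommRing A] [Algebra A k] {b : Fin n → ℚ}
    (hb : ∀ i, 0 < b i) (hx : IsStable A b x) : IsKLTAt b x := by
  rw [isKLTAt_iff hb]
  intro C hne hC
  by_contra! htight
  obtain ⟨hss, hclosed, hfin⟩ := hx
  have hss0 := isSemistable_limitPoint x hC hss htight
  have : Infinite kˣ := infinite_units
  have horb : limitPoint x hC ∈ MulAction.orbit (Torus k n) x := by
    by_contra hnot
    obtain ⟨O, hO, hOeq⟩ := isOpen_induced_iff.1 hclosed.isOpen_compl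
    have h0 : limitPoint x hC ∈ O := by
      have : (⟨_, hss0⟩ : {y : UniversalFamily k r n // IsSemistable A b y}) ∈ Subtype.val ⁻¹' O := by
        rw [hOeq]; exact hnot
      exact this
    obtain ⟨τ, hτ⟩ := (finite_setOf_notMem x hC hO h0).infinite_compl.nonempty
    have h1 : oneParameter C τ • x ∈ O := not_not.1 hτ
    have h2 : (⟨_, hss.smul (oneParameter C τ)⟩ :
        {y : UniversalFamily k r n // IsSemistable A b y}) ∈ Subtype.val ⁻¹' O := h1
    rw [hOeq] at h2
    exact h2 (mem_orbit_torus.2 ⟨_, rfl⟩)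
  obtain ⟨t, ht⟩ := mem_orbit_torus.1 horb
  have hfix : ∀ σ : kˣ, oneParameter C σ • x = x := by
    intro σ
    have h1 := oneParameter_smul_limitPoint x hC σ
    rw [ht, smul_smul, mul_comm, ← smul_smul] at h1
    exact smul_left_cancel t h1
  let f : kˣ → MulAction.stabilizer (Torus k n) x := fun σ =>
    ⟨(oneParameter C σ : Torus k n), hfix σ⟩
  -- An index in `C` and one off `C`, where `p` has a nonzero coordinate, separate the parameters
  -- modulo the diagonal.
  have hf : Function.Injective f := by
    intro σ σ' h
    have h1 := QuotientGroup.eq.1 (congrArg Subtype.val h)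
    obtain ⟨c, hc⟩ := h1
    obtain ⟨i, hi⟩ := hne
    obtain ⟨j, hj⟩ : ∃ j, x.point.rep j ≠ 0 := by
      by_contra! h0
      exact x.point.rep_nonzero (funext h0)
    have hjC : j ∉ C := fun h => hj (hC j h)
    have h2 := congrFun hc i
    have h3 := congrFun hc j
    simp [oneParameter, hi, hjC] at h2 h3
    rw [h2] at h3
    exact (inv_mul_eq_one.1 h3.symm)
  exact not_finite_iff_infinite.2 (Infinite.of_injective f hf) hfin

end Degeneration

/-! ### Kawamata log terminal points are stable -/

section Stable

open Filter Topology

variable {k : Type*} [Field k] {r n : ℕ}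

/-- A point of the matroid polytope below `b` can be moved to one that involves all bases. -/
theorem exists_full_combination {V : Gr k r n} {b y : Fin n → ℝ} (hy : y ∈ matroidPolytope V)
    (hlt : ∀ i, y i < b i) : ∃ c : PluckerIndex r n → ℝ, (∀ I, 0 ≤ c I) ∧
      (∀ I, c I = 0 ↔ plucker V I = 0) ∧ ∑ I, c I = 1 ∧
      ∀ i, (∑ I, c I • indicatorPoint I) i < b i := by
  classical
  obtain ⟨d, hd0, hdV, hd1, rfl⟩ := mem_matroidPolytope.1 hy
  let s : Finset (PluckerIndex r n) := Finset.univ.filter fun I => plucker V I ≠ 0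
  have hs : 0 < s.card := by
    obtain ⟨I, -, hI⟩ := Finset.exists_ne_zero_of_sum_ne_zero (hd1.trans_ne one_ne_zero)
    exact Finset.card_pos.2 ⟨I, Finset.mem_filter.2 ⟨Finset.mem_univ I, hdV I hI⟩⟩
  have hs' : (0 : ℝ) < s.card := by exact_mod_cast hs
  -- The uniform combination of all bases. A small admixture of it makes every weight positive and
  -- preserves the strict inequalities.
  let e : PluckerIndex r n → ℝ := fun I => if plucker V I ≠ 0 then (s.card : ℝ)⁻¹ else 0
  have he0 : ∀ I, 0 ≤ e I := fun I => by
    simp only [e]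
    split_ifs <;> positivity
  have he1 : ∑ I, e I = 1 := by
    simp only [e]
    rw [← Finset.sum_filter, Finset.sum_const, nsmul_eq_mul, mul_inv_cancel₀ hs'.ne']
  let c : ℝ → PluckerIndex r n → ℝ := fun ε I => (1 - ε) * d I + ε * e I
  have hlim : ∀ᶠ ε in 𝓝[>] (0 : ℝ), ∀ i, (∑ I, c ε I • indicatorPoint I) i < b i := by
    refine eventually_all.2 fun i => (Tendsto.mono_left ?_ nhdsWithin_le_nhds).eventually_lt_const
      (hlt i)
    have hcont : Continuous fun ε => (∑ I, c ε I • indicatorPoint I) i := by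
      simp only [c, Finset.sum_apply, Pi.smul_apply, smul_eq_mul]
      fun_prop
    have := hcont.tendsto 0
    simpa [c] using this
  obtain ⟨ε, hε, hε0, hε1⟩ := (hlim.and (Ioo_mem_nhdsGT (zero_lt_one' ℝ))).exists
  refine ⟨c ε, fun I => ?_, fun I => ⟨fun h => ?_, fun h => ?_⟩, ?_, hε⟩
  · exact add_nonneg (mul_nonneg (sub_pos.2 hε1).le (hd0 I)) (mul_nonneg hε0.le (he0 I))
  · by_contra hne
    have h1 : 0 < e I := by simp only [e, if_pos hne]; positivity
    have h2 := mul_nonneg (sub_pos.2 hε1).le (hd0 I)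
    have h3 := mul_pos hε0 h1
    simp only [c] at h
    linarith
  · have h1 : d I = 0 := by_contra fun h0 => hdV I h0 h
    simp [c, e, h, h1]
  · simp only [c]
    rw [Finset.sum_add_distrib, ← Finset.mul_sum, ← Finset.mul_sum, hd1, he1]
    ring

/-- At a Kawamata log terminal point, there is an invariant monomial in which exactly the
nonvanishing coordinates occur. -/
theorem exists_full_exponent (x : UniversalFamily k r n) {b : Fin n → ℚ} {y : Fin n → ℝ}
    (hy : y ∈ matroidPolytope x.space) (hlt : ∀ i, y i < b i)
    (hklt : ∀ C : Finset (Fin n), C.Nonempty → (∀ i ∈ C, x.point.rep i = 0) →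
      ∑ i ∈ C, b i < codim x.space C) :
    ∃ (N : ℕ) (u : Coord r n →₀ ℕ), 0 < N ∧ IsInvariantExponent b N u ∧
      ∀ j, u j = 0 ↔ x.coord j = 0 := by
  classical
  obtain ⟨d, hd0, hdV, hd1, hdlt⟩ := exists_full_combination hy hlt
  let y₁ : Fin n → ℝ := ∑ I, d I • indicatorPoint I
  have hy₁ : y₁ ∈ matroidPolytope x.space :=
    mem_matroidPolytope.2 ⟨d, hd0, fun I hI h => hI ((hdV I).2 h), hd1, rfl⟩
  have hlim : ∀ᶠ ε in 𝓝[>] (0 : ℝ), ∀ C : Finset (Fin n), C.Nonempty →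
      (∀ i ∈ C, x.point.rep i = 0) →
      ∑ i ∈ C, ((b i : ℝ) - ε * y₁ i) < (1 - ε) * codim x.space C := by
    refine eventually_all.2 fun C => ?_
    by_cases hC : C.Nonempty ∧ ∀ i ∈ C, x.point.rep i = 0
    · have h1 : Tendsto (fun ε : ℝ => ∑ i ∈ C, ((b i : ℝ) - ε * y₁ i)) (𝓝 0)
          (𝓝 (∑ i ∈ C, (b i : ℝ))) := by
        have : Continuous fun ε : ℝ => ∑ i ∈ C, ((b i : ℝ) - ε * y₁ i) := by fun_prop
        simpa using this.tendsto 0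
      have h2 : Tendsto (fun ε : ℝ => (1 - ε) * (codim x.space C : ℝ)) (𝓝 0)
          (𝓝 (codim x.space C : ℝ)) := by
        have : Continuous fun ε : ℝ => (1 - ε) * (codim x.space C : ℝ) := by fun_prop
        simpa using this.tendsto 0
      have h3 : ∑ i ∈ C, (b i : ℝ) < (codim x.space C : ℝ) := by
        exact_mod_cast hklt C hC.1 hC.2
      filter_upwards [nhdsWithin_le_nhds (h1.eventually_lt h2 h3)] with ε hε _ _ using hε
    · exact Eventually.of_forall fun ε hne hz => absurd ⟨hne, hz⟩ hC
  obtain ⟨ε, hε, hε0, hε1⟩ := (hlim.and (Ioo_mem_nhdsGT (zero_lt_one' ℝ))).exists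
  have hε1' : 0 < 1 - ε := sub_pos.2 hε1
  -- Chosen so that `(1 - ε) * b' + ε * y₁` is `b` at vanishing coordinates and `y₁ < b` at the
  -- others. The admixture of `y₁` makes all bases occur; strictness of the klt inequalities keeps
  -- `b'` below the rank function for small `ε`.
  let b' : Fin n → ℝ := fun i => if x.point.rep i = 0 then (b i - ε * y₁ i) / (1 - ε) else y₁ i
  obtain ⟨y', hy', hle, heq⟩ := exists_le_and_eqOn x.space b'
    (Finset.univ.filter fun i => x.point.rep i = 0) ⟨y₁, hy₁, fun i => by
      simp only [b']
      split_ifs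
      · rw [le_div_iff₀ hε1']
        have : y₁ i < b i := hdlt i
        linarith
      · exact le_rfl⟩
    fun C hCZ hne => by
      have hz : ∀ i ∈ C, x.point.rep i = 0 := fun i hi => (Finset.mem_filter.1 (hCZ hi)).2
      rw [Finset.sum_congr rfl fun i hi => show b' i = (b i - ε * y₁ i) / (1 - ε) from if_pos (hz i hi),
        ← Finset.sum_div, div_le_iff₀ hε1', mul_comm]
      exact (hε C hne hz).le
  obtain ⟨c, hc0, hcV, hc1, rfl⟩ := mem_matroidPolytope.1 hy'
  let ρ : PluckerIndex r n → ℝ := fun I => (1 - ε) * c I + ε * d I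
  have hρ : ∀ i, (∑ I, ρ I • indicatorPoint I) i =
      (1 - ε) * (∑ I, c I • indicatorPoint I) i + ε * y₁ i := by
    intro i
    simp only [ρ, y₁, Finset.sum_apply, Pi.smul_apply, smul_eq_mul, add_mul, Finset.sum_add_distrib,
      Finset.mul_sum, mul_assoc]
  have hz : ∀ i, x.point.rep i = 0 → (∑ I, ρ I • indicatorPoint I) i = b i := by
    intro i hi
    rw [hρ, heq i (Finset.mem_filter.2 ⟨Finset.mem_univ i, hi⟩)]
    simp only [b', if_pos hi]
    field_simp
    ring
  have hnz : ∀ i, x.point.rep i ≠ 0 → (∑ I, ρ I • indicatorPoint I) i < b i := by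
    intro i hi
    rw [hρ]
    have h1 := hle i
    simp only [b', if_neg hi] at h1
    have h2 : y₁ i < b i := hdlt i
    nlinarith
  obtain ⟨N, u, hN, hu, hsupp⟩ := exists_invariantExponent b
    (Sum.elim (fun i => b i - (∑ I, ρ I • indicatorPoint I) i) ρ)
    (by rintro (i | I)
        · by_cases hi : x.point.rep i = 0
          · exact (sub_eq_zero.2 (hz i hi).symm).ge
          · exact (sub_pos.2 (hnz i hi)).le
        · exact add_nonneg (mul_nonneg hε1'.le (hc0 I)) (mul_nonneg hε0.le (hd0 I)))
    (by intro i; rw [sum_mul_character]; simp)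
    (by simp only [Sum.elim_inr, ρ]
        rw [Finset.sum_add_distrib, ← Finset.mul_sum, ← Finset.mul_sum, hc1, hd1]
        ring)
  refine ⟨N, u, hN, hu, ?_⟩
  rintro (i | I)
  · rw [hsupp, Sum.elim_inl, coord_inl]
    refine ⟨fun h => by_contra fun hi => ?_, fun h => sub_eq_zero.2 (hz i h).symm⟩
    exact (sub_pos.2 (hnz i hi)).ne' h
  · rw [hsupp, Sum.elim_inr, coord_inr, ← hdV]
    constructor
    · intro h
      by_contra hne
      have h1 := mul_nonneg hε1'.le (hc0 I)
      have h2 := mul_pos hε0 (lt_of_le_of_ne (hd0 I) (Ne.symm hne))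
      simp only [ρ] at h
      linarith
    · intro h
      have : c I = 0 := by_contra fun h0 => hcV I h0 ((hdV I).1 h)
      simp [ρ, h, this]

/-- The stabilizer of a Kawamata log terminal point is trivial. -/
theorem mem_diagonal_of_smul_eq (x : UniversalFamily k r n) {b : Fin n → ℚ} {y : Fin n → ℝ}
    (hy : y ∈ matroidPolytope x.space) (hle : ∀ i, y i ≤ b i)
    (hklt : ∀ C : Finset (Fin n), C.Nonempty → (∀ i ∈ C, x.point.rep i = 0) →
      ∑ i ∈ C, b i < codim x.space C) {t : Fin n → kˣ} (ht : t • x = x) :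
    t ∈ diagonal k n := by
  classical
  obtain ⟨μ, ν, h⟩ := coord_smul t x
  rw [ht] at h
  have h' : ∀ j, x.coord j ≠ 0 → scale t μ ν j = 1 := fun j hj =>
    Units.ext (mul_right_cancel₀ hj ((h j).symm.trans (one_mul _).symm))
  -- Nonvanishing `z i` force `t i = μ⁻¹`, so `z` vanishes on `D`. Two bases differing by an
  -- exchange have equal products of `t`, so exchanges preserve `D`. A nonempty `D` would thus be
  -- tight, against the klt inequality.
  let D : Finset (Fin n) := Finset.univ.filter fun i => t i ≠ μ⁻¹
  have hDz : ∀ i ∈ D, x.point.rep i = 0 := by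
    intro i hi
    by_contra hne
    have := h' (Sum.inl i) hne
    rw [scale_inl] at this
    exact (Finset.mem_filter.1 hi).2 (eq_inv_of_mul_eq_one_left this)
  have hD : D = ∅ := by
    by_contra hne
    have hne := Finset.nonempty_iff_ne_empty.2 hne
    obtain ⟨c, -, hcV, hc1, rfl⟩ := mem_matroidPolytope.1 hy
    have h1 := sum_eq_codim_of_closed hc1 hcV (C := D) fun I hI l hl hlI j hj hbase => by
      have e1 := h' (Sum.inr I) (hcV I hI)
      have e2 := h' (Sum.inr ⟨_, hbase.1⟩) ((plucker_ne_zero_iff x.space ⟨_, hbase.1⟩).2 hbase)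
      rw [scale_inr] at e1 e2
      have e3 := mul_right_cancel (e1.trans e2.symm)
      rw [Finset.prod_insert (fun h => hlI (Finset.mem_of_mem_erase h)),
        ← Finset.mul_prod_erase _ _ hj] at e3
      refine Finset.mem_filter.2 ⟨Finset.mem_univ j, ?_⟩
      rw [mul_right_cancel e3]
      exact (Finset.mem_filter.1 hl).2
    have h2 : ((∑ i ∈ D, b i : ℚ) : ℝ) < (codim x.space D : ℝ) := by
      exact_mod_cast hklt D hne hDz
    rw [← h1] at h2
    push_cast at h2
    exact absurd (Finset.sum_le_sum fun i _ => hle i) (not_le.2 h2)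
  refine ⟨μ⁻¹, funext fun i => ?_⟩
  by_contra hne
  have : i ∈ D := Finset.mem_filter.2 ⟨Finset.mem_univ i, fun h => hne h.symm⟩
  rw [hD] at this
  exact absurd this (Finset.notMem_empty i)

/-- Relations among elements of a lattice that hold among elements of a divisible group are
induced by a homomorphism. -/
theorem exists_addMonoidHom_extension {ι M Q : Type*} [Fintype ι] [AddCommGroup M] [AddCommGroup Q]
    [DivisibleBy Q ℤ] (p : ι → Prop) (a : ι → M) (q : ι → Q)
    (h : ∀ u : ι → ℤ, (∀ j, ¬ p j → u j = 0) → ∑ j, u j • a j = 0 → ∑ j, u j • q j = 0) :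
    ∃ χ : M →+ Q, ∀ j, p j → χ (a j) = q j := by
  classical
  let L : Submodule ℤ (ι → ℤ) :=
    { carrier := {u | ∀ j, ¬ p j → u j = 0}
      add_mem' := fun hu hv j hj => by rw [Pi.add_apply, hu j hj, hv j hj, add_zero]
      zero_mem' := fun j _ => rfl
      smul_mem' := fun c u hu j hj => by rw [Pi.smul_apply, hu j hj, smul_zero] }
  let f : L →ₗ[ℤ] M := Fintype.linearCombination ℤ a ∘ₗ L.subtype
  let g : L →ₗ[ℤ] Q := Fintype.linearCombination ℤ q ∘ₗ L.subtype
  have hfg : LinearMap.ker f ≤ LinearMap.ker g := fun u hu => h u.1 u.2 hu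
  -- `g` factors through the quotient by `ker f`, which embeds in `M`; divisible groups are
  -- injective, so the map extends to `M`.
  obtain ⟨χ, hχ⟩ := Module.Baer.extension_property (Module.Baer.of_divisible Q)
    ((LinearMap.ker f).liftQ f le_rfl)
    (LinearMap.ker_eq_bot.1 (Submodule.ker_liftQ_eq_bot _ _ _ le_rfl))
    ((LinearMap.ker f).liftQ g hfg)
  refine ⟨χ.toAddMonoidHom, fun j hj => ?_⟩
  have h1 := LinearMap.congr_fun hχ ((LinearMap.ker f).mkQ ⟨Pi.single j 1, fun i hi => by
    rw [Pi.single_eq_of_ne]; rintro rfl; exact hi hj⟩)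
  simpa [f, g] using h1

theorem nonempty_divisibleBy_units [IsAlgClosed k] : Nonempty (DivisibleBy (Additive kˣ) ℤ) := by
  let _ : DivisibleBy (Additive kˣ) ℕ := divisibleByOfSMulRightSurj _ _ (by
    intro m hm a
    obtain ⟨z, hz⟩ := IsAlgClosed.exists_pow_nat_eq ((Additive.toMul a : kˣ) : k)
      (Nat.pos_of_ne_zero hm)
    have hz0 : z ≠ 0 := by
      rintro rfl
      rw [zero_pow hm] at hz
      exact (Additive.toMul a).ne_zero hz.symm
    exact ⟨Additive.ofMul (Units.mk0 z hz0), congrArg Additive.ofMul (Units.ext hz)⟩)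
  exact ⟨AddGroup.divisibleByIntOfDivisibleByNat _⟩

/-- The value of a monomial at a point. -/
def monomialValue (x : UniversalFamily k r n) (u : Coord r n →₀ ℕ) : k := ∏ j, x.coord j ^ u j

theorem aeval_monomial_coord (x : UniversalFamily k r n) (u : Coord r n →₀ ℕ) (c : k) :
    MvPolynomial.aeval x.coord (MvPolynomial.monomial u c) = c * monomialValue x u := by
  rw [MvPolynomial.aeval_monomial, Finsupp.prod_fintype _ _ (by simp)]
  rfl

/-! ### Equations satisfied on an orbit closure -/

theorem aeval_eq_zero_of_mem_closure {x y : UniversalFamily k r n}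
    (hy : y ∈ closure (MulAction.orbit (Torus k n) x)) {F : MvPolynomial (Coord r n) k} {d : ℕ × ℕ}
    (hF : MvPolynomial.IsWeightedHomogeneous (bidegree r n) F d)
    (h : ∀ t : Fin n → kˣ, MvPolynomial.aeval (t • x).coord F = 0) :
    MvPolynomial.aeval y.coord F = 0 := by
  by_contra hne
  obtain ⟨z, hz, hzo⟩ := mem_closure_iff.1 hy {x | MvPolynomial.aeval x.coord F ≠ 0}
    (TopologicalSpace.isOpen_generateFrom_of_mem ⟨d, F, hF, rfl⟩) hne
  obtain ⟨t, rfl⟩ := mem_orbit_torus.1 hzo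
  exact hz (h t)

theorem coord_eq_zero_of_mem_closure {x y : UniversalFamily k r n}
    (hy : y ∈ closure (MulAction.orbit (Torus k n) x)) {j : Coord r n} (hj : x.coord j = 0) :
    y.coord j = 0 := by
  have := aeval_eq_zero_of_mem_closure hy (MvPolynomial.isWeightedHomogeneous_X k _ j) fun t => by
    obtain ⟨μ, ν, h⟩ := coord_smul t x
    rw [MvPolynomial.aeval_X, h, hj, mul_zero]
  rwa [MvPolynomial.aeval_X] at this

/-- Two monomials of equal weight are multiplied by the same factor along the orbit. The
corresponding binomial vanishes on the orbit, hence on its closure. -/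
theorem monomialValue_mul_of_mem_closure {x y : UniversalFamily k r n}
    (hy : y ∈ closure (MulAction.orbit (Torus k n) x)) {u v : Coord r n →₀ ℕ}
    (hchar : Finsupp.weight (character r n) u = Finsupp.weight (character r n) v)
    (hdeg : Finsupp.weight (bidegree r n) u = Finsupp.weight (bidegree r n) v) :
    monomialValue x u * monomialValue y v = monomialValue x v * monomialValue y u := by
  have := aeval_eq_zero_of_mem_closure hy
    (F := MvPolynomial.monomial v (monomialValue x u) - MvPolynomial.monomial u (monomialValue x v))
    ((MvPolynomial.isWeightedHomogeneous_monomial _ _ _ rfl).sub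
      (MvPolynomial.isWeightedHomogeneous_monomial _ _ _ hdeg)) fun t => by
    obtain ⟨μ, ν, h⟩ := coord_smul t x
    have hval : ∀ w : Coord r n →₀ ℕ, monomialValue (t • x) w =
        ((∏ j, scale t μ ν j ^ w j : kˣ) : k) * monomialValue x w := by
      intro w
      simp only [monomialValue, h, mul_pow, Finset.prod_mul_distrib]
      push_cast
      rfl
    rw [map_sub, aeval_monomial_coord, aeval_monomial_coord, hval, hval, prod_scale_pow,
      prod_scale_pow, hchar, hdeg]
    ring
  rw [map_sub, aeval_monomial_coord, aeval_monomial_coord] at this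
  exact sub_eq_zero.1 this

theorem monomialValue_ne_zero {x : UniversalFamily k r n} {u : Coord r n →₀ ℕ}
    (h : ∀ j, x.coord j = 0 → u j = 0) : monomialValue x u ≠ 0 :=
  Finset.prod_ne_zero_iff.2 fun j _ => by
    by_cases hj : x.coord j = 0
    · rw [h j hj, pow_zero]; exact one_ne_zero
    · exact pow_ne_zero _ hj

/-- A semistable limit cannot lose a nonvanishing coordinate, because the full monomial `u` stays
nonzero on it. The coordinate ratios then satisfy every relation among the weights and so define a
character-compatible torus element. -/
theorem mem_orbit_of_mem_closure [IsAlgClosed k] {A : Type*} [CommRing A] [Algebra A k]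
    {b : Fin n → ℚ} {x y : UniversalFamily k r n} {N : ℕ} {u : Coord r n →₀ ℕ}
    (hu : IsInvariantExponent b N u) (hsupp : ∀ j, u j = 0 ↔ x.coord j = 0)
    (hss : IsSemistable A b y) (hy : y ∈ closure (MulAction.orbit (Torus k n) x)) :
    y ∈ MulAction.orbit (Torus k n) x := by
  classical
  obtain ⟨N', u', hN', hu', hsupp'⟩ := (isSemistable_iff_exponent A b y).1 hss
  have hne : ∀ j, x.coord j ≠ 0 → y.coord j ≠ 0 := by
    intro j hj hyj
    -- The multiples `N • u'` and `N' • u` have the same weight. If `y.coord j = 0`, the right side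
    -- vanishes because `j` occurs in `u`, whereas both factors on the left are nonzero.
    have h1 := monomialValue_mul_of_mem_closure hy (u := N • u') (v := N' • u)
      (by
        rw [map_nsmul, map_nsmul]
        funext i
        have : ((N • Finsupp.weight (character r n) u') i : ℚ) =
            ((N' • Finsupp.weight (character r n) u) i : ℕ) := by
          simp only [Pi.smul_apply, smul_eq_mul, Nat.cast_mul, hu.1, hu'.1]
          ring
        exact_mod_cast this)
      (by
        rw [map_nsmul, map_nsmul]
        refine Prod.ext ?_ ?_
        · have : ((N • (Finsupp.weight (bidegree r n) u').1 : ℕ) : ℚ) =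
              ((N' • (Finsupp.weight (bidegree r n) u).1 : ℕ) : ℚ) := by
            simp only [smul_eq_mul, Nat.cast_mul, hu.bidegree_fst, hu'.bidegree_fst]
            ring
          exact_mod_cast this
        · rw [Prod.smul_snd, Prod.smul_snd, hu.2, hu'.2, smul_eq_mul, smul_eq_mul, mul_comm])
    have h2 : monomialValue y (N' • u) = 0 := Finset.prod_eq_zero (Finset.mem_univ j) (by
      rw [hyj, zero_pow]
      exact mul_ne_zero hN'.ne' fun h0 => hj ((hsupp j).1 h0))
    rw [h2, mul_zero] at h1
    refine mul_ne_zero ?_ ?_ h1.symm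
    · exact monomialValue_ne_zero fun i hi => by simp [(hsupp i).2 hi]
    · exact monomialValue_ne_zero fun i hi => by simp [hsupp' i hi]
  let q : Coord r n → kˣ := fun j =>
    if h : x.coord j ≠ 0 then Units.mk0 (y.coord j / x.coord j) (div_ne_zero (hne j h) h) else 1
  have hq : ∀ j, x.coord j ≠ 0 → y.coord j = q j * x.coord j := by
    intro j hj
    simp only [q, dif_pos hj, Units.val_mk0]
    rw [div_mul_cancel₀ _ hj]
  have hqv : ∀ v : Coord r n →₀ ℕ, (∀ j, x.coord j = 0 → v j = 0) →
      monomialValue y v = ((∏ j, q j ^ v j : kˣ) : k) * monomialValue x v := by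
    intro v hv
    rw [Units.coe_prod, monomialValue, monomialValue, ← Finset.prod_mul_distrib]
    refine Finset.prod_congr rfl fun j _ => ?_
    by_cases hj : x.coord j = 0
    · rw [hv j hj]; simp
    · rw [hq j hj, mul_pow, Units.val_pow_eq_pow_val]
  -- The full weight of each coordinate. A homomorphism to `kˣ` sending `a j` to `q j` amounts to a
  -- triple `(t, μ, ν)` with `scale t μ ν j = q j`.
  let a : Coord r n → (Fin n → ℤ) × ℤ × ℤ := fun j =>
    (fun i => character r n j i, ((bidegree r n j).1 : ℤ), ((bidegree r n j).2 : ℤ))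
  obtain ⟨_⟩ := nonempty_divisibleBy_units (k := k)
  obtain ⟨χ, hχ⟩ := exists_addMonoidHom_extension (fun j => x.coord j ≠ 0) a
    (fun j => Additive.ofMul (q j)) (by
      intro w hw h0
      -- Positive and negative parts of an integral relation are two monomials of equal weight, to
      -- which the binomial equations apply.
      let v₁ : Coord r n →₀ ℕ := Finsupp.equivFunOnFinite.symm fun j => (w j).toNat
      let v₂ : Coord r n →₀ ℕ := Finsupp.equivFunOnFinite.symm fun j => (-w j).toNat
      have hv : ∀ j, w j = (v₁ j : ℤ) - v₂ j := fun j => (Int.toNat_sub_toNat_neg _).symm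
      have hv₁ : ∀ j, x.coord j = 0 → v₁ j = 0 := fun j hj => by
        simp [v₁, hw j (not_not.2 hj)]
      have hv₂ : ∀ j, x.coord j = 0 → v₂ j = 0 := fun j hj => by
        simp [v₂, hw j (not_not.2 hj)]
      have hsub : ∀ f : Coord r n → ℕ, ∑ j, w j * (f j : ℤ) = 0 →
          ∑ j, v₁ j * f j = ∑ j, v₂ j * f j := by
        intro f hf
        simp only [hv, sub_mul, Finset.sum_sub_distrib] at hf
        exact_mod_cast sub_eq_zero.1 hf
      have hchar : Finsupp.weight (character r n) v₁ = Finsupp.weight (character r n) v₂ := by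
        funext i
        rw [weight_character, weight_character]
        refine hsub _ ?_
        have := congrFun (congrArg Prod.fst h0) i
        simpa [a, Prod.fst_sum, -Fintype.sum_sum_type] using this
      have hdeg : Finsupp.weight (bidegree r n) v₁ = Finsupp.weight (bidegree r n) v₂ := by
        rw [weight_apply_fintype, weight_apply_fintype]
        refine Prod.ext ?_ ?_
        · rw [Prod.fst_sum, Prod.fst_sum]
          refine hsub (fun j => (bidegree r n j).1) ?_
          have := congrArg (fun z => z.2.1) h0
          simpa [a, Prod.fst_sum, Prod.snd_sum, -Fintype.sum_sum_type] using this
        · rw [Prod.snd_sum, Prod.snd_sum]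
          refine hsub (fun j => (bidegree r n j).2) ?_
          have := congrArg (fun z => z.2.2) h0
          simpa [a, Prod.snd_sum, -Fintype.sum_sum_type] using this
      have h1 := monomialValue_mul_of_mem_closure hy hchar hdeg
      rw [hqv _ hv₁, hqv _ hv₂] at h1
      have hx₁ := monomialValue_ne_zero hv₁
      have hx₂ := monomialValue_ne_zero hv₂
      have h2 : (∏ j, q j ^ v₂ j : kˣ) = ∏ j, q j ^ v₁ j := by
        refine Units.ext (mul_right_cancel₀ (mul_ne_zero hx₁ hx₂) ?_)
        linear_combination h1
      apply Additive.toMul.injective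
      rw [toMul_sum, toMul_zero]
      simp only [toMul_zsmul, toMul_ofMul, hv, zpow_sub, zpow_natCast]
      rw [Finset.prod_mul_distrib, Finset.prod_inv_distrib, h2, mul_inv_cancel])
  let t : Fin n → kˣ := fun i => Additive.toMul (χ (Pi.single i 1, 0, 0))
  let μ : kˣ := Additive.toMul (χ (0, 1, 0))
  let ν : kˣ := Additive.toMul (χ (0, 0, 1))
  have ha : ∀ j, a j = ∑ i, character r n j i • ((Pi.single i 1, 0, 0) : (Fin n → ℤ) × ℤ × ℤ) +
      (bidegree r n j).1 • ((0, 1, 0) : (Fin n → ℤ) × ℤ × ℤ) +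
      (bidegree r n j).2 • ((0, 0, 1) : (Fin n → ℤ) × ℤ × ℤ) := by
    intro j
    refine Prod.ext (funext fun i => ?_) (Prod.ext ?_ ?_)
    · simp [a, Prod.fst_sum, Finset.sum_apply, Pi.single_apply]
    · simp [a, Prod.snd_sum]
    · simp [a, Prod.snd_sum]
  have hscale : ∀ j, x.coord j ≠ 0 → q j = scale t μ ν j := by
    intro j hj
    apply Additive.ofMul.injective
    rw [← hχ j hj, ha, map_add, map_add, map_sum, map_nsmul, map_nsmul, scale, ofMul_mul, ofMul_mul,
      ofMul_prod, ofMul_pow, ofMul_pow]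
    simp only [map_nsmul, ofMul_pow]
    rfl
  -- The Plücker degree of `u'` is `N' > 0`, so some `p_I` occurs in it and is nonzero at `y`, as
  -- `eq_smul_of_coord` requires.
  obtain ⟨I, -, hI⟩ := Finset.exists_ne_zero_of_sum_ne_zero
    (((weight_bidegree_snd u').symm.trans hu'.2).trans_ne hN'.ne')
  refine mem_orbit_torus.2 ⟨t, eq_smul_of_coord t μ ν (fun j => ?_) I fun h => hI (hsupp' _ h)⟩
  by_cases hj : x.coord j = 0
  · rw [hj, mul_zero, coord_eq_zero_of_mem_closure hy hj]
  · rw [hq j hj, hscale j hj]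

theorem isStable_of_isKLTAt [IsAlgClosed k] (A : Type*) [CommRing A] [Algebra A k] {b : Fin n → ℚ}
    (hb : ∀ i, 0 < b i) (x : UniversalFamily k r n) {y : Fin n → ℝ}
    (hy : y ∈ matroidPolytope x.space) (hlt : ∀ i, y i < b i) (hklt : IsKLTAt b x) :
    IsStable A b x := by
  rw [isKLTAt_iff hb] at hklt
  obtain ⟨N, u, hN, hu, hsupp⟩ := exists_full_exponent x hy hlt hklt
  refine ⟨(isSemistable_iff_exponent A b x).2 ⟨N, u, hN, hu, fun j => (hsupp j).2⟩, ?_, ?_⟩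
  · rw [isClosed_induced_iff]
    refine ⟨closure (MulAction.orbit (Torus k n) x), isClosed_closure, ?_⟩
    ext z
    exact ⟨mem_orbit_of_mem_closure hu hsupp z.2, fun h => subset_closure h⟩
  · have : Subsingleton (MulAction.stabilizer (Torus k n) x) := by
      refine subsingleton_of_forall_eq 1 ?_
      rintro ⟨g, hg⟩
      obtain ⟨t, rfl⟩ := QuotientGroup.mk_surjective g
      exact Subtype.ext ((QuotientGroup.eq_one_iff t).2
        (mem_diagonal_of_smul_eq x hy (fun i => (hlt i).le) hklt hg))
    infer_instance

end Stable

end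

end HyperplaneGIT

theorem theorem6 {A : Type*} [CommRing A] {k : Type*} [Field k] [IsAlgClosed k] [Algebra A k]
    (r n : ℕ) (b : Fin n → ℚ) (hb : b ∈ weightDomain r n) (V : Gr k r n) :
    ((matroidPolytope V ∩ weightedHypersimplex r b = ∅ ∨ ∃ i, V.1 ≤ coordHyperplane k i) →
      ∀ (p : ℙ k (Fin n → k)) (hp : p.submodule ≤ V.1),
        ¬ IsSemistable A b (⟨p, V, hp⟩ : UniversalFamily k r n)) ∧
    ((matroidPolytope V ∩ weightedHypersimplex r b).Nonempty →
      ∀ (p : ℙ k (Fin n → k)) (hp : p.submodule ≤ V.1),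
        IsSemistable A b (⟨p, V, hp⟩ : UniversalFamily k r n) ↔
          IsLCAt b (⟨p, V, hp⟩ : UniversalFamily k r n)) ∧
    ((matroidPolytope V ∩ intrinsicInterior ℝ (weightedHypersimplex r b)).Nonempty →
      ∀ (p : ℙ k (Fin n → k)) (hp : p.submodule ≤ V.1),
        IsStable A b (⟨p, V, hp⟩ : UniversalFamily k r n) ↔
          IsKLTAt b (⟨p, V, hp⟩ : UniversalFamily k r n)) := by
  have hb0 : ∀ i, 0 < b i := fun i => (hb.1 i).1
  refine ⟨fun h p hp => not_isSemistable A hb0 ⟨p, V, hp⟩ h,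
    fun h p hp => isSemistable_iff_isLCAt A hb0 ⟨p, V, hp⟩ h, ?_⟩
  rintro ⟨y, hy, hyΔ⟩ p hp
  -- For `r = 0` the space `ℙV` is empty, so the existence of `p` excludes this case.
  have hr : 0 < r := by
    by_contra h0
    have hV : V.1 = ⊥ := Submodule.finrank_eq_zero.1 (V.2.trans (Nat.eq_zero_of_not_pos h0))
    have hmem := rep_mem (⟨p, V, hp⟩ : UniversalFamily k r n)
    exact p.rep_nonzero ((Submodule.mem_bot k).1 (hV ▸ hmem))
  exact ⟨isKLTAt_of_isStable _ A hb0, isStable_of_isKLTAt A hb0 ⟨p, V, hp⟩ hy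
    fun i => (lt_of_mem_intrinsicInterior hb hr hyΔ i).2⟩
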